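/- Let $\lambda$ denote Lebesgue measure on $\mathbb{R}$, let $K\subset\mathbb{R}$ be a compact set with $\lambda(K)>0$, and let $d\ge 1$ be an integer. Let $C(K,\mathbb{R}^d)$ be the additive group of continuous maps $K\to\mathbb{R}^d$ with the maximum norm, which is an abelian Polish group. A subset $A$ of an abelian Polish group $G$ is called shy if there are a Borel set $B\subset G$ and a Borel probability measure $\mu$ on $G$ such that $A\subset B$ and $\mu(B+x)=0$ for all $x\in G$; the complement of a shy set is called prevalent. Then the set of all $f\in C(K,\mathbb{R}^d)$ for which there exists an open set $U_f\subset\mathbb{R}^d$ with $$\lambda\bigl(f^{-1}(U_f)\bigr)=\lambda(K)\quad\text{and}\quad \dim_H f^{-1}(y)=1\ \text{ for all } y\in U_f$$ is prevalent in $C(K,\mathbb{R}^d)$, where $\dim_H$ denotes Hausdorff dimension. -/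

import Mathlib

open MeasureTheory Set

/-- A subset `A` of an abelian Polish group `G` is *shy* (Haar null) if there are a Borel set
`B ⊇ A` and a Borel probability measure `μ` on `G` such that `μ (B + x) = 0` for all `x : G`.
Here `B + x` is the translate, written as the image of `B` under `b ↦ b + x`. -/
def IsShy {G : Type*} [AddCommGroup G] [TopologicalSpace G] [IsTopologicalAddGroup G]
    [PolishSpace G] (A : Set G) : Prop :=
  ∃ (B : Set G) (μ : @Measure G (borel G)),
    MeasurableSet[borel G] B ∧ A ⊆ B ∧ @IsProbabilityMeasure G (borel G) μ ∧
      ∀ x : G, μ ((fun b => b + x) '' B) = 0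

/-- A subset of an abelian Polish group is *prevalent* if its complement is shy. -/
def IsPrevalent {G : Type*} [AddCommGroup G] [TopologicalSpace G] [IsTopologicalAddGroup G]
    [PolishSpace G] (A : Set G) : Prop :=
  IsShy Aᶜ

/-!
The witness measure is the law of a random series `X(t) = ∑ bᵢ(t) ωᵢ`, where the `bᵢ` are the
functions `cos (π 2ⁿ t / R) / (n + 1)²` and `sin (π 2ⁿ t / R) / (n + 1)²` and the `ωᵢ` are
independent vectors in the unit ball with a common smooth density. Points at distance about `R 2⁻ⁿ`
are separated by one of the two terms of order `n`, so the characteristic function of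
`X(s) - X(t)` at `ξ` is at most a power of `n` times any prescribed negative power of `1 + ‖ξ‖`.
The modulus of continuity of `X` is only a power of a logarithm, and this is what makes its fibres as large
as possible. Adding a deterministic function `g` multiplies the characteristic functions of the
increments by numbers of modulus one, so all bounds are uniform in `g`.

For `f = X + g` and a set `S ⊆ K` of diameter `R 2⁻ᵏ`, the occupation measure of `f` on `S` (the
image of Lebesgue measure on `S`) has expected squared Sobolev norm at most `λ(S) 2⁻ᵏ` up to a power
of `k + 1` (`exists_lintegral_sobolevEnergy_le`). Hence the `totalEnergy`, a weighted sum of these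
norms over all dyadic cells, is almost surely finite for every `g`. Since the total energy is a
Borel function of `f`, the functions of infinite total energy form the required Borel null set.

The rest is deterministic. If the total energy is finite, the occupation measure of `f` on `K` has a
continuous density, and the set `U` where it is positive is open and carries the whole measure
(`exists_isOpen_ball_lower_bound`), so that `f ⁻¹' U` has full measure. Let `y ∈ U`, and suppose that
the fibre over `y` has a covering with small `∑ diam ^ α`, `α < 1`. By compactness the covering still
covers the preimage of a small ball around `y`. The preimage has measure at least a constant times
the volume of the ball; on the other hand each dyadic cell contributes at most the volume of the
ball times the supremum of the density of the occupation measure of that cell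
(`measure_ball_le_sobolevEnergy`). For most cells this supremum is of order at most `2 ^ (-α k)`, and the
exceptional cells are negligible by the finiteness of the energy. This contradicts the smallness
of the covering (`lower_density_le_cover`), so the dimension of the fibre is at least `α`.
-/

/-! ### Measures of finite Sobolev energy -/

section Fourier

open Filter Topology FourierTransform RealInnerProductSpace
open scoped ENNReal SchwartzMap ContDiff

variable {V : Type*} [NormedAddCommGroup V] [InnerProductSpace ℝ V] [FiniteDimensional ℝ V]
  [MeasurableSpace V] [BorelSpace V]

/-- The Fourier transform `ξ ↦ ∫ exp (-2πi⟪x, ξ⟫) dν(x)` of a measure on a Euclidean space. -/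
noncomputable def measureFourier (ν : Measure V) (ξ : V) : ℂ := charFun ν (-(2 * Real.pi) • ξ)

/-- The candidate density of `ν`: the inverse Fourier transform of its Fourier transform. -/
noncomputable def fourierDensity (ν : Measure V) : V → ℂ := 𝓕⁻ (measureFourier ν)

/-- The squared Sobolev norm `∫ (1 + ‖ξ‖) ^ (dim V + 1) ‖ν̂(ξ)‖² dξ` of a measure `ν`. -/
noncomputable def sobolevEnergy (ν : Measure V) : ℝ≥0∞ :=
  ∫⁻ ξ, ENNReal.ofReal ((1 + ‖ξ‖) ^ (Module.finrank ℝ V + 1)) * ‖measureFourier ν ξ‖ₑ ^ 2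

omit [FiniteDimensional ℝ V] [BorelSpace V] in
lemma measureFourier_eq (ν : Measure V) (ξ : V) :
    measureFourier ν ξ =
      VectorFourier.fourierIntegral Real.fourierChar ν (innerₗ V) (fun _ => (1 : ℂ)) ξ := by
  rw [measureFourier, charFun_apply, VectorFourier.fourierIntegral]
  congr with x
  simp only [innerₗ_apply_apply, Circle.smul_def, Real.fourierChar_apply, smul_eq_mul, mul_one,
    inner_smul_right]
  congr 2
  push_cast
  ring

lemma measurable_measureFourier (ν : Measure V) [IsFiniteMeasure ν] :
    Measurable (measureFourier ν) :=
  measurable_charFun.comp (measurable_const_smul _)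

/-- Fourier inversion for measures, tested against Schwartz functions: it follows from inversion
for the test function by exchanging integrals. -/
lemma integral_schwartz_eq (ν : Measure V) [IsFiniteMeasure ν]
    (hν : Integrable (measureFourier ν)) (φ : 𝓢(V, ℂ)) :
    ∫ x, φ x ∂ν = ∫ x, φ x * fourierDensity ν x := by
  have hL : Continuous fun p : V × V ↦ (innerₗ V) p.1 p.2 := continuous_inner
  have hL' : Continuous fun p : V × V ↦ (-innerₗ V) p.1 p.2 := by
    change Continuous fun p : V × V => -⟪p.1, p.2⟫
    exact continuous_inner.neg
  have h1 := VectorFourier.integral_fourierIntegral_smul_eq_flip (L := innerₗ V)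
    (μ := (volume : Measure V)) (ν := ν) (f := (𝓕⁻ φ : 𝓢(V, ℂ))) (g := fun _ => (1 : ℂ))
    Real.continuous_fourierChar hL (𝓕⁻ φ : 𝓢(V, ℂ)).integrable (integrable_const _)
  have h2 := VectorFourier.integral_fourierIntegral_smul_eq_flip (L := -innerₗ V)
    (μ := (volume : Measure V)) (ν := (volume : Measure V)) (f := φ) (g := measureFourier ν)
    Real.continuous_fourierChar hL' φ.integrable hν
  have h3 : ∀ x, VectorFourier.fourierIntegral Real.fourierChar volume (innerₗ V)
      (𝓕⁻ φ : 𝓢(V, ℂ)) x = φ x := by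
    intro x
    change 𝓕 ((𝓕⁻ φ : 𝓢(V, ℂ)) : V → ℂ) x = φ x
    rw [← SchwartzMap.fourier_coe, FourierTransform.fourier_fourierInv_eq]
  have hf : (-innerₗ V).flip = -innerₗ V := by
    ext; simp [real_inner_comm]
  simp only [h3, flip_innerₗ, smul_eq_mul, mul_one] at h1
  rw [h1]
  simp only [hf, smul_eq_mul] at h2
  rw [fourierDensity]
  simp only [← measureFourier_eq]
  rw [SchwartzMap.fourierInv_coe]
  exact h2

lemma continuous_fourierDensity (ν : Measure V) (hν : Integrable (measureFourier ν)) :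
    Continuous (fourierDensity ν) :=
  VectorFourier.fourierIntegral_continuous Real.continuous_fourierChar
    (by change Continuous fun p : V × V => -⟪p.1, p.2⟫; exact continuous_inner.neg) hν

lemma norm_fourierDensity_le (ν : Measure V) (x : V) :
    ‖fourierDensity ν x‖ ≤ ∫ ξ, ‖measureFourier ν ξ‖ :=
  VectorFourier.norm_fourierIntegral_le_integral_norm _ _ _ _ _

/-- `ν` has density `re (fourierDensity ν)` when tested against smooth functions of compact
support. -/
lemma integral_smooth_eq (ν : Measure V) [IsFiniteMeasure ν]
    (hν : Integrable (measureFourier ν)) {φ : V → ℝ} (hφ : ContDiff ℝ ∞ φ)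
    (hc : HasCompactSupport φ) :
    ∫ x, φ x ∂ν = ∫ x, φ x * (fourierDensity ν x).re := by
  have hc' : HasCompactSupport (fun x => (φ x : ℂ)) := hc.comp_left (g := fun t : ℝ => (t : ℂ)) rfl
  have h := integral_schwartz_eq ν hν
    (hc'.toSchwartzMap (Complex.ofRealCLM.contDiff.comp hφ))
  change ∫ x, (φ x : ℂ) ∂ν = ∫ x, (φ x : ℂ) * fourierDensity ν x at h
  have hint : Integrable (fun x => (φ x : ℂ) * fourierDensity ν x) := by
    refine Continuous.integrable_of_hasCompactSupport ?_ hc'.mul_right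
    exact (Complex.continuous_ofReal.comp hφ.continuous).mul (continuous_fourierDensity ν hν)
  have h' := congrArg Complex.re h
  rw [integral_complex_ofReal, Complex.ofReal_re] at h'
  have h2 : ∫ x, ((φ x : ℂ) * fourierDensity ν x).re = (∫ x, (φ x : ℂ) * fourierDensity ν x).re :=
    integral_re hint
  rw [h']
  simp_rw [Complex.re_ofReal_mul] at h2
  exact h2.symm

/-- A Sobolev bound controls the `L¹` norm of the Fourier transform. The bound comes from
`a ≤ θ + a² / θ` with a weight, so that it is linear in the energy. -/
lemma lintegral_measureFourier_le :
    ∃ C : ℝ≥0∞, C ≠ ⊤ ∧ ∀ (ν : Measure V) [IsFiniteMeasure ν] (θ : ℝ), 0 < θ →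
      ∫⁻ ξ, ‖measureFourier ν ξ‖ₑ ≤
        C * (ENNReal.ofReal θ + sobolevEnergy ν * ENNReal.ofReal θ⁻¹) := by
  set D := Module.finrank ℝ V
  set W : ℝ≥0∞ := ∫⁻ ξ : V, ENNReal.ofReal ((1 + ‖ξ‖) ^ (-((D : ℝ) + 1))) with hW
  have hWfin : W ≠ ⊤ := (finite_integral_one_add_norm (by simp [D])).ne
  refine ⟨W + 1, by simp [hWfin], fun ν _ θ hθ => ?_⟩
  have key : ∀ ξ : V, ‖measureFourier ν ξ‖ₑ ≤
      ENNReal.ofReal θ * ENNReal.ofReal ((1 + ‖ξ‖) ^ (-((D : ℝ) + 1))) +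
      ENNReal.ofReal θ⁻¹ *
        (ENNReal.ofReal ((1 + ‖ξ‖) ^ (D + 1)) * ‖measureFourier ν ξ‖ₑ ^ 2) := by
    intro ξ
    rw [← ofReal_norm, ← ENNReal.ofReal_pow (norm_nonneg _), ← ENNReal.ofReal_mul hθ.le,
      ← ENNReal.ofReal_mul (by positivity), ← ENNReal.ofReal_mul (by positivity),
      ← ENNReal.ofReal_add (by positivity) (by positivity)]
    apply ENNReal.ofReal_le_ofReal
    set a := ‖measureFourier ν ξ‖
    have hw : (1 + ‖ξ‖) ^ (-((D : ℝ) + 1)) = ((1 + ‖ξ‖) ^ (D + 1))⁻¹ := by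
      rw [Real.rpow_neg (by positivity)]
      norm_cast
    rw [hw]
    set w := (1 + ‖ξ‖) ^ (D + 1)
    have hw0 : 0 < w := by positivity
    have : θ * w⁻¹ + θ⁻¹ * (w * a ^ 2) - a = ((θ - w * a) ^ 2 + θ * w * a) / (θ * w) := by
      field_simp
      ring
    have h2 : 0 ≤ ((θ - w * a) ^ 2 + θ * w * a) / (θ * w) := by positivity
    linarith
  calc ∫⁻ ξ, ‖measureFourier ν ξ‖ₑ
      ≤ ENNReal.ofReal θ * W + ENNReal.ofReal θ⁻¹ * sobolevEnergy ν := by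
        refine (lintegral_mono key).trans ?_
        rw [lintegral_add_left (by fun_prop), lintegral_const_mul _ (by fun_prop), sobolevEnergy,
          lintegral_const_mul']
        exact ENNReal.ofReal_ne_top
    _ ≤ ENNReal.ofReal θ * (W + 1) + ENNReal.ofReal θ⁻¹ * sobolevEnergy ν * (W + 1) := by
        exact add_le_add (by gcongr; exact le_self_add) (le_mul_of_one_le_right' le_add_self)
    _ = _ := by ring

lemma integrable_measureFourier (ν : Measure V) [IsFiniteMeasure ν] (h : sobolevEnergy ν ≠ ⊤) :
    Integrable (measureFourier ν) := by
  obtain ⟨C, hC, hle⟩ := lintegral_measureFourier_le (V := V)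
  refine ⟨(measurable_measureFourier ν).aestronglyMeasurable, (hle ν 1 one_pos).trans_lt ?_⟩
  have : C * (ENNReal.ofReal 1 + sobolevEnergy ν * ENNReal.ofReal 1⁻¹) ≠ ⊤ := by
    finiteness
  exact this.lt_top

/-- A measure of finite Sobolev energy gives mass of order `r ^ dim V` to balls of radius `r`. -/
lemma measure_ball_le_sobolevEnergy :
    ∃ C : ℝ≥0∞, C ≠ ⊤ ∧ ∀ (ν : Measure V) [IsFiniteMeasure ν] (y : V) (r θ : ℝ), 0 < r → 0 < θ →
      ν (Metric.ball y r) ≤ C * ENNReal.ofReal (r ^ Module.finrank ℝ V) *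
        (ENNReal.ofReal θ + sobolevEnergy ν * ENNReal.ofReal θ⁻¹) := by
  obtain ⟨C, hC, hle⟩ := lintegral_measureFourier_le (V := V)
  set D := Module.finrank ℝ V
  set v : ℝ≥0∞ := volume (Metric.ball (0 : V) 1)
  refine ⟨ENNReal.ofReal (2 ^ D) * v * C + 1, by
    have : v ≠ ⊤ := measure_ball_lt_top.ne
    finiteness, fun ν _ y r θ hr hθ => ?_⟩
  by_cases hE : sobolevEnergy ν = ⊤
  · rw [hE, ENNReal.top_mul (by simpa using hθ), add_top, ENNReal.mul_top]
    · exact le_top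
    · simpa using by positivity
  have hint := integrable_measureFourier ν hE
  let φ : ContDiffBump y := ⟨r, 2 * r, hr, by linarith⟩
  have h1 : ν.real (Metric.ball y r) ≤ ∫ x, φ x ∂ν := by
    rw [← integral_indicator_one Metric.isOpen_ball.measurableSet]
    refine integral_mono_of_nonneg (ae_of_all _ fun x => indicator_nonneg (by simp) x) ?_
      (ae_of_all _ fun x => ?_)
    · exact φ.continuous.integrable_of_hasCompactSupport φ.hasCompactSupport
    · simp only [indicator]
      split_ifs with hx
      · exact (φ.one_of_mem_closedBall (Metric.ball_subset_closedBall hx)).ge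
      · exact φ.nonneg
  have h2 : ∫ x, φ x ∂ν ≤ volume.real (Metric.ball y (2 * r)) * ∫ ξ, ‖measureFourier ν ξ‖ := by
    rw [integral_smooth_eq ν hint φ.contDiff φ.hasCompactSupport, ← smul_eq_mul,
      ← integral_indicator_const _ Metric.isOpen_ball.measurableSet]
    refine integral_mono ?_ ?_ fun x => ?_
    · refine Continuous.integrable_of_hasCompactSupport ?_ φ.hasCompactSupport.mul_right
      exact φ.continuous.mul (Complex.continuous_re.comp (continuous_fourierDensity ν hint))
    · exact (integrableOn_const measure_ball_lt_top.ne).integrable_indicator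
        Metric.isOpen_ball.measurableSet
    · simp only [indicator]
      split_ifs with hx
      · have ha : (fourierDensity ν x).re ≤ ∫ ξ, ‖measureFourier ν ξ‖ :=
          (Complex.re_le_norm _).trans (norm_fourierDensity_le ν x)
        have hb : 0 ≤ ∫ ξ, ‖measureFourier ν ξ‖ := integral_nonneg fun _ => norm_nonneg _
        nlinarith [φ.nonneg (x := x), φ.le_one (x := x)]
      · have : φ x = 0 := φ.zero_of_le_dist (by simpa using hx)
        simp [this]
  have h3 : ν (Metric.ball y r) ≤
      volume (Metric.ball y (2 * r)) * ∫⁻ ξ, ‖measureFourier ν ξ‖ₑ := by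
    have := ENNReal.ofReal_le_ofReal (h1.trans h2)
    rwa [Measure.real, ENNReal.ofReal_toReal (measure_ne_top _ _),
      ENNReal.ofReal_mul measureReal_nonneg, ofReal_integral_norm_eq_lintegral_enorm hint,
      Measure.real, ENNReal.ofReal_toReal measure_ball_lt_top.ne] at this
  refine h3.trans ((mul_le_mul_right (hle ν θ hθ) _).trans ?_)
  rw [Measure.addHaar_ball_of_pos _ _ (by positivity), mul_pow, ENNReal.ofReal_mul (by positivity)]
  calc _ = (ENNReal.ofReal (2 ^ D) * v * C) * ENNReal.ofReal (r ^ D) *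
        (ENNReal.ofReal θ + sobolevEnergy ν * ENNReal.ofReal θ⁻¹) := by ring
    _ ≤ _ := by gcongr; exact le_self_add

/-- A measure of finite Sobolev energy is carried by an open set at each point of which its
lower density is positive, namely the set where its continuous density is positive. -/
lemma exists_isOpen_ball_lower_bound (ν : Measure V) [IsFiniteMeasure ν]
    (h : sobolevEnergy ν ≠ ⊤) :
    ∃ U : Set V, IsOpen U ∧ ν Uᶜ = 0 ∧ ∀ y ∈ U, ∃ c : ℝ≥0∞, c ≠ 0 ∧ ∃ r₀ : ℝ, 0 < r₀ ∧
      ∀ r : ℝ, 0 < r → r < r₀ →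
        c * ENNReal.ofReal (r ^ Module.finrank ℝ V) ≤ ν (Metric.ball y r) := by
  have hint := integrable_measureFourier ν h
  set L : V → ℝ := fun x => (fourierDensity ν x).re with hL
  have hLc : Continuous L := Complex.continuous_re.comp (continuous_fourierDensity ν hint)
  refine ⟨{x | 0 < L x}, isOpen_lt continuous_const hLc, ?_, fun y hy => ?_⟩
  · have hcl : IsClosed {x : V | 0 < L x}ᶜ := (isOpen_lt continuous_const hLc).isClosed_compl
    -- it suffices to treat the bounded parts of the closed set where the density is not positive
    have hpart : ∀ n : ℕ, ν ({x : V | 0 < L x}ᶜ ∩ Metric.closedBall 0 n) = 0 := by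
      intro n
      set N := {x : V | 0 < L x}ᶜ ∩ Metric.closedBall 0 n
      have hNcl : IsClosed N := hcl.inter Metric.isClosed_closedBall
      have hle : ∀ ε : ℝ, 0 < ε → ν.real N ≤ ε * volume.real (Metric.ball (0 : V) (n + 1)) := by
        intro ε hε
        have hO : IsOpen ({x : V | L x < ε} ∩ Metric.ball (0 : V) (n + 1)) :=
          (isOpen_lt hLc continuous_const).inter Metric.isOpen_ball
        have hNO : N ⊆ {x : V | L x < ε} ∩ Metric.ball (0 : V) (n + 1) := by
          rintro x ⟨hx1, hx2⟩
          refine ⟨(show L x ≤ 0 from not_lt.1 hx1).trans_lt hε, ?_⟩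
          simp only [Metric.mem_closedBall, Metric.mem_ball] at hx2 ⊢
          linarith
        obtain ⟨φ, hφ, hrange, h0, h1⟩ := exists_contMDiff_zero_iff_one_iff_of_isClosed
          (n := (⊤ : ℕ∞)) (modelWithCornersSelf ℝ V) hO.isClosed_compl hNcl
          (disjoint_compl_left_iff_subset.2 hNO)
        have hφ' : ContDiff ℝ ∞ φ := hφ.contDiff
        have hφ01 : ∀ x, 0 ≤ φ x ∧ φ x ≤ 1 := fun x => hrange ⟨x, rfl⟩
        have hφc : HasCompactSupport φ := by
          refine HasCompactSupport.intro (isCompact_closedBall (0 : V) (n + 1)) fun x hx => ?_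
          exact (h0 x).1 fun hx' => hx (Metric.ball_subset_closedBall hx'.2)
        calc ν.real N ≤ ∫ x, φ x ∂ν := by
              rw [← integral_indicator_one hNcl.measurableSet]
              refine integral_mono_of_nonneg (ae_of_all _ fun x => indicator_nonneg (by simp) x)
                (hφ'.continuous.integrable_of_hasCompactSupport hφc) (ae_of_all _ fun x => ?_)
              simp only [indicator]
              split_ifs with hx
              · exact ((h1 x).1 hx).ge
              · exact (hφ01 x).1
          _ = ∫ x, φ x * L x := integral_smooth_eq ν hint hφ' hφc
          _ ≤ ∫ x, (Metric.ball (0 : V) (n + 1)).indicator (fun _ => ε) x := by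
              refine integral_mono ?_ ?_ fun x => ?_
              · exact Continuous.integrable_of_hasCompactSupport (hφ'.continuous.mul hLc)
                  hφc.mul_right
              · exact (integrableOn_const measure_ball_lt_top.ne).integrable_indicator
                  Metric.isOpen_ball.measurableSet
              · by_cases hx : x ∈ {x : V | L x < ε} ∩ Metric.ball (0 : V) (n + 1)
                · rw [indicator_of_mem hx.2]
                  have := hx.1
                  change L x < ε at this
                  nlinarith [hφ01 x]
                · simp only [(h0 x).1 hx, zero_mul]
                  exact indicator_nonneg (fun _ _ => hε.le) x
          _ = ε * volume.real (Metric.ball (0 : V) (n + 1)) := by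
              rw [integral_indicator_const _ Metric.isOpen_ball.measurableSet, smul_eq_mul,
                mul_comm]
      have hlim : Tendsto (fun ε : ℝ => ε * volume.real (Metric.ball (0 : V) (n + 1)))
          (𝓝[>] 0) (𝓝 0) := by
        have : Tendsto (fun ε : ℝ => ε * volume.real (Metric.ball (0 : V) (n + 1)))
          (𝓝 0) (𝓝 (0 * volume.real (Metric.ball (0 : V) (n + 1)))) :=
          tendsto_id.mul_const _
        rw [zero_mul] at this
        exact this.mono_left nhdsWithin_le_nhds
      have hz : ν.real N ≤ 0 := ge_of_tendsto hlim
        (eventually_nhdsWithin_of_forall fun ε hε => hle ε hε)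
      have := le_antisymm hz measureReal_nonneg
      rwa [measureReal_eq_zero_iff] at this
    have hU : {x : V | 0 < L x}ᶜ = ⋃ n : ℕ, {x : V | 0 < L x}ᶜ ∩ Metric.closedBall 0 n := by
      rw [← inter_iUnion, Metric.iUnion_closedBall_nat, inter_univ]
    rw [hU]
    exact measure_iUnion_null hpart
  · set a := L y
    have ha : 0 < a := hy
    have hnear : ∀ᶠ x in 𝓝 y, a / 2 < L x :=
      hLc.continuousAt.eventually (lt_mem_nhds (by linarith))
    obtain ⟨r₀, hr₀, hball⟩ := Metric.eventually_nhds_iff_ball.1 hnear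
    refine ⟨ENNReal.ofReal (a / 2) * (ENNReal.ofReal ((1 / 2) ^ Module.finrank ℝ V) *
      volume (Metric.ball (0 : V) 1)), ?_, r₀, hr₀, fun r hr hr' => ?_⟩
    · refine mul_ne_zero (by simpa using ha) (mul_ne_zero ?_ ?_)
      · simp only [ne_eq, ENNReal.ofReal_eq_zero, not_le]
        positivity
      · exact (Metric.measure_ball_pos _ _ one_pos).ne'
    let φ : ContDiffBump y := ⟨r / 2, r, by linarith, by linarith⟩
    have h1 : ∫ x, φ x ∂ν ≤ ν.real (Metric.ball y r) := by
      rw [← integral_indicator_one Metric.isOpen_ball.measurableSet]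
      refine integral_mono_of_nonneg (ae_of_all _ fun x => φ.nonneg) ?_
        (ae_of_all _ fun x => ?_)
      · exact (integrable_const (1 : ℝ)).integrableOn.integrable_indicator
          Metric.isOpen_ball.measurableSet
      · simp only [indicator]
        split_ifs with hx
        · exact φ.le_one
        · exact (φ.zero_of_le_dist (by simpa using hx)).le
    have h2 : a / 2 * volume.real (Metric.ball y (r / 2)) ≤ ∫ x, φ x ∂ν := by
      rw [integral_smooth_eq ν hint φ.contDiff φ.hasCompactSupport, mul_comm, ← smul_eq_mul,
        ← integral_indicator_const _ Metric.isOpen_ball.measurableSet]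
      refine integral_mono ?_ ?_ fun x => ?_
      · exact (integrableOn_const measure_ball_lt_top.ne).integrable_indicator
          Metric.isOpen_ball.measurableSet
      · exact Continuous.integrable_of_hasCompactSupport (φ.continuous.mul hLc)
          φ.hasCompactSupport.mul_right
      · by_cases hx : x ∈ Metric.ball y r
        · have hx2 : a / 2 < L x := hball x (Metric.ball_subset_ball hr'.le hx)
          simp only [indicator]
          split_ifs with hx'
          · rw [φ.one_of_mem_closedBall (Metric.ball_subset_closedBall hx'), one_mul]
            exact hx2.le
          · exact mul_nonneg φ.nonneg (by linarith)
        · have h0 : φ x = 0 := φ.zero_of_le_dist (by simpa using hx)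
          have hx' : x ∉ Metric.ball y (r / 2) := fun hx' =>
            hx (Metric.ball_subset_ball (by linarith) hx')
          simp [h0, indicator_of_notMem hx']
    have h3 := ENNReal.ofReal_le_ofReal (h2.trans h1)
    rw [ENNReal.ofReal_mul (by positivity), Measure.real,
      ENNReal.ofReal_toReal measure_ball_lt_top.ne, Measure.real,
      ENNReal.ofReal_toReal (measure_ne_top _ _), Measure.addHaar_ball_of_pos _ _ (by positivity),
      div_eq_mul_one_div r 2, mul_pow, ENNReal.ofReal_mul (by positivity)] at h3
    refine le_trans (le_of_eq ?_) h3
    ring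

end Fourier

/-! ### Occupation measures and the dimension of fibres -/

section Dimension

open Filter Topology
open scoped ENNReal

/-- Lebesgue measure on a subset of the line, as a measure on the subtype. -/
noncomputable def subtypeVolume (K : Set ℝ) : Measure K := (volume : Measure ℝ).comap Subtype.val

lemma subtypeVolume_apply {K : Set ℝ} [CompactSpace K] (S : Set K) :
    subtypeVolume K S = volume (Subtype.val '' S) := by
  have hK : IsCompact K := isCompact_iff_compactSpace.2 inferInstance
  exact (MeasurableEmbedding.subtype_coe hK.measurableSet).comap_apply _ _

instance isFiniteMeasure_subtypeVolume (K : Set ℝ) [CompactSpace K] :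
    IsFiniteMeasure (subtypeVolume K) := by
  have hK : IsCompact K := isCompact_iff_compactSpace.2 inferInstance
  refine ⟨?_⟩
  rw [subtypeVolume_apply, Subtype.coe_image_univ]
  exact hK.measure_lt_top

/-- The occupation measure of `f` on `S`: the image under `f` of Lebesgue measure on `S`. -/
noncomputable def occupation {V : Type*} [MeasurableSpace V] {K : Set ℝ} (f : K → V) (S : Set K) :
    Measure V :=
  ((subtypeVolume K).restrict S).map f

instance isFiniteMeasure_occupation {V : Type*} [MeasurableSpace V] {K : Set ℝ} [CompactSpace K]
    (f : K → V) (S : Set K) : IsFiniteMeasure (occupation f S) := by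
  unfold occupation
  infer_instance

/-- The part of `K` in the `j`-th interval of length `R * 2⁻ᵏ` of the `R`-scaled dyadic grid. -/
def dyadicCell (K : Set ℝ) (R : ℝ) (k : ℕ) (j : ℤ) : Set K := {x | ⌊2 ^ k * (x : ℝ) / R⌋ = j}

lemma measurableSet_dyadicCell (K : Set ℝ) (R : ℝ) (k : ℕ) (j : ℤ) :
    MeasurableSet (dyadicCell K R k j) := by
  have : Measurable fun x : K => ⌊2 ^ k * (x : ℝ) / R⌋ := by fun_prop
  exact this (measurableSet_singleton j)

/-- A length `d` is compared with a dyadic scale `R 2⁻ᵏ` above it. The summand `e` takes care of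
`d = 0`. -/
lemma exists_dyadic_scale {R α d e : ℝ} (hR : 0 < R) (hα : 0 < α) (hd : 0 ≤ d) (he : 0 < e)
    (N : ℕ) (hdN : d ≤ R * 2⁻¹ ^ N / 2) :
    ∃ k, N ≤ k ∧ d < R * 2⁻¹ ^ k ∧ (2⁻¹ ^ k : ℝ) ^ α ≤ (4 / R) ^ α * (d ^ α + e) := by
  rcases hd.eq_or_lt with rfl | hd
  · have hlim : Tendsto (fun k : ℕ => ((2⁻¹ : ℝ) ^ k) ^ α) atTop (𝓝 0) := by
      have h1 : Tendsto (fun k : ℕ => (2⁻¹ : ℝ) ^ k) atTop (𝓝 0) :=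
        tendsto_pow_atTop_nhds_zero_of_lt_one (by norm_num) (by norm_num)
      simpa [Real.zero_rpow hα.ne'] using h1.rpow_const (p := α) (Or.inr hα.le)
    obtain ⟨k, hk1, hk2⟩ := ((hlim.eventually (gt_mem_nhds
      (show (0 : ℝ) < (4 / R) ^ α * e by positivity))).and (eventually_ge_atTop N)).exists
    refine ⟨k, hk2, by positivity, ?_⟩
    rw [Real.zero_rpow hα.ne', zero_add]
    exact hk1.le
  · have hx : 2 * d / R ≤ 2⁻¹ ^ N := by
      rw [div_le_iff₀ hR]; linarith
    obtain ⟨k, hk1, hk2⟩ := exists_nat_pow_near_of_lt_one (x := 2 * d / R) (y := (2⁻¹ : ℝ))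
      (by positivity) (hx.trans (pow_le_one₀ (by norm_num) (by norm_num))) (by norm_num)
      (by norm_num)
    refine ⟨k, ?_, ?_, ?_⟩
    · have h1 : (2⁻¹ : ℝ) ^ (k + 1) < 2⁻¹ ^ N := hk1.trans_le hx
      have := (pow_lt_pow_iff_right_of_lt_one₀ (by norm_num) (by norm_num)).1 h1
      omega
    · rw [div_le_iff₀ hR] at hk2
      linarith
    · have h1 : (2⁻¹ : ℝ) ^ k ≤ 4 / R * d := by
        rw [pow_succ] at hk1
        have : 4 / R * d = 2 * (2 * d / R) := by ring
        linarith
      calc ((2⁻¹ : ℝ) ^ k) ^ α ≤ (4 / R * d) ^ α :=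
            Real.rpow_le_rpow (by positivity) h1 hα.le
        _ = (4 / R) ^ α * d ^ α := Real.mul_rpow (by positivity) hd.le
        _ ≤ _ := by gcongr; linarith

variable {V : Type*} [NormedAddCommGroup V] [InnerProductSpace ℝ V] [FiniteDimensional ℝ V]
  [MeasurableSpace V] [BorelSpace V]

/-- If the fibre over `y` has zero `α`-dimensional Hausdorff measure, then the lower density `c` of
the occupation measure at `y` is bounded by the tail of the weighted energies of the dyadic cells
plus an arbitrarily small covering cost. Cells whose energy is at most `θ²`, with
`θ = 2 ^ (-α k)`, are charged to the covering; the remaining ones contribute to the tail. -/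
lemma lower_density_le_cover {K : Set ℝ} [CompactSpace K] (f : C(K, V)) {R α : ℝ} (hR : 0 < R)
    (hα : 0 < α) {C : ℝ≥0∞}
    (hC : ∀ (ν : Measure V) [IsFiniteMeasure ν] (y : V) (r θ : ℝ), 0 < r → 0 < θ →
      ν (Metric.ball y r) ≤ C * ENNReal.ofReal (r ^ Module.finrank ℝ V) *
        (ENNReal.ofReal θ + sobolevEnergy ν * ENNReal.ofReal θ⁻¹))
    {y : V} {c : ℝ≥0∞} {r₀ : ℝ} (hr₀ : 0 < r₀)
    (hy : ∀ r : ℝ, 0 < r → r < r₀ →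
      c * ENNReal.ofReal (r ^ Module.finrank ℝ V) ≤ occupation f univ (Metric.ball y r))
    (hH : Measure.hausdorffMeasure α (Subtype.val '' (f ⁻¹' {y}) : Set ℝ) = 0)
    (N : ℕ) {η : ℝ} (hη : 0 < η) :
    c ≤ 2 * C * ((∑' k, ∑' j, ENNReal.ofReal ((2⁻¹ ^ (k + N)) ^ α)⁻¹ *
        sobolevEnergy (occupation f (dyadicCell K R (k + N) j))) +
      9 * ENNReal.ofReal ((4 / R) ^ α) * ENNReal.ofReal η) := by
  set D := Module.finrank ℝ V
  -- a cheap covering of the fibre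
  obtain ⟨t, ht, htd, hts⟩ : ∃ t : ℕ → Set ℝ, (Subtype.val '' (f ⁻¹' {y}) : Set ℝ) ⊆ ⋃ n, t n ∧
      (∀ n, Metric.ediam (t n) ≤ ENNReal.ofReal (R * 2⁻¹ ^ N / 2)) ∧
      ∑' n, Metric.ediam (t n) ^ α < ENNReal.ofReal η := by
    rw [Measure.hausdorffMeasure_apply] at hH
    have h1 := (iSup₂_eq_bot.1 hH (ENNReal.ofReal (R * 2⁻¹ ^ N / 2))
      (by rw [ENNReal.ofReal_pos]; positivity))
    have h2 : (⊥ : ℝ≥0∞) < ENNReal.ofReal η := by simpa using hη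
    rw [← h1] at h2
    simp only [iInf_lt_iff] at h2
    obtain ⟨t, h3, h4, h5⟩ := h2
    refine ⟨t, h3, h4, lt_of_le_of_lt (ENNReal.tsum_le_tsum fun n => ?_) h5⟩
    rcases (t n).eq_empty_or_nonempty with h | h
    · simp [h, ENNReal.zero_rpow_of_pos hα]
    · simp [h]
  have hfin : ∀ n, Metric.ediam (t n) ≠ ⊤ := fun n => ((htd n).trans_lt ENNReal.ofReal_lt_top).ne
  choose k hkN hkd hkα using fun n : ℕ => exists_dyadic_scale (d := (Metric.ediam (t n)).toReal)
    (e := η * 2⁻¹ ^ n) hR hα ENNReal.toReal_nonneg (by positivity) N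
    (ENNReal.toReal_le_of_le_ofReal (by positivity) (htd n))
  have hcov : ∀ n, ∃ x : ℝ, t n ⊆ Metric.ball x (R * 2⁻¹ ^ k n) := by
    intro n
    rcases (t n).eq_empty_or_nonempty with h | ⟨x, hx⟩
    · exact ⟨0, by simp [h]⟩
    · refine ⟨x, fun z hz => ?_⟩
      rw [Metric.mem_ball]
      refine lt_of_le_of_lt ?_ (hkd n)
      rw [dist_edist]
      exact ENNReal.toReal_mono (hfin n) (Metric.edist_le_ediam_of_mem hz hx)
  choose x hx using hcov
  -- by compactness the covering by balls also covers the preimage of a small ball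
  obtain ⟨r, hr, hrr, hrO⟩ : ∃ r, 0 < r ∧ r < r₀ ∧
      f ⁻¹' (Metric.ball y r) ⊆ Subtype.val ⁻¹' (⋃ n, Metric.ball (x n) (R * 2⁻¹ ^ k n)) := by
    set O : Set K := Subtype.val ⁻¹' (⋃ n, Metric.ball (x n) (R * 2⁻¹ ^ k n))
    have hO : IsOpen O :=
      (isOpen_iUnion fun n => Metric.isOpen_ball).preimage continuous_subtype_val
    have hcl : IsClosed (f '' Oᶜ) := (hO.isClosed_compl.isCompact.image f.continuous).isClosed
    have hyn : y ∉ f '' Oᶜ := by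
      rintro ⟨z, hz, hzy⟩
      apply hz
      obtain ⟨n, hn⟩ := mem_iUnion.1 (ht ⟨z, hzy, rfl⟩)
      exact mem_iUnion.2 ⟨n, hx n hn⟩
    obtain ⟨ρ, hρ, hball⟩ := Metric.isOpen_iff.1 hcl.isOpen_compl y hyn
    refine ⟨min ρ (r₀ / 2), by positivity, (min_le_right _ _).trans_lt (by linarith),
      fun z hz => ?_⟩
    by_contra hzO
    exact hball (Metric.ball_subset_ball (min_le_left _ _) hz) ⟨z, hzO, rfl⟩
  set B := Metric.ball y r
  set θ : ℕ → ℝ := fun k => (2⁻¹ ^ k : ℝ) ^ α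
  have hθ : ∀ k, 0 < θ k := fun k => by positivity
  set E : ℕ → ℤ → ℝ≥0∞ := fun k j => sobolevEnergy (occupation f (dyadicCell K R k j))
  set ρ : ℝ≥0∞ := ENNReal.ofReal (r ^ D)
  have hρ0 : ρ ≠ 0 := by simp only [ρ, ne_eq, ENNReal.ofReal_eq_zero, not_le]; positivity
  have hρt : ρ ≠ ⊤ := ENNReal.ofReal_ne_top
  set P : ℕ → ℤ → Set K := fun k j => dyadicCell K R k j ∩ f ⁻¹' B
  have hP : ∀ k j, subtypeVolume K (P k j) ≤
      C * ρ * (ENNReal.ofReal (θ k) + E k j * ENNReal.ofReal (θ k)⁻¹) := by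
    intro k j
    have h1 : occupation f (dyadicCell K R k j) B = subtypeVolume K (P k j) := by
      rw [occupation, Measure.map_apply f.continuous.measurable Metric.isOpen_ball.measurableSet,
        Measure.restrict_apply (f.continuous.measurable Metric.isOpen_ball.measurableSet),
        inter_comm]
    rw [← h1]
    exact hC _ y r (θ k) hr (hθ k)
  -- the bound `hP` is dominated by its first summand on good cells and by the second on bad ones
  set good : ℕ → ℤ → Prop := fun k j => E k j * ENNReal.ofReal (θ k)⁻¹ ≤ ENNReal.ofReal (θ k)
  set G : ℕ → ℤ → Set K := fun k j => {z ∈ P k j | good k j}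
  set G' : ℕ → ℤ → Set K := fun k j => {z ∈ P k j | ¬ good k j}
  have hG : ∀ k j, subtypeVolume K (G k j) ≤ 2 * C * ρ * ENNReal.ofReal (θ k) := by
    intro k j
    by_cases hg : good k j
    · refine (measure_mono (sep_subset _ _)).trans ((hP k j).trans ?_)
      calc _ ≤ C * ρ * (ENNReal.ofReal (θ k) + ENNReal.ofReal (θ k)) := by gcongr
        _ = _ := by ring
    · simp [G, hg]
  have hG' : ∀ k j, subtypeVolume K (G' k j) ≤ 2 * C * ρ * (ENNReal.ofReal (θ k)⁻¹ * E k j) := by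
    intro k j
    by_cases hg : good k j
    · simp [G', hg]
    · refine (measure_mono (sep_subset _ _)).trans ((hP k j).trans ?_)
      calc _ ≤ C * ρ * (E k j * ENNReal.ofReal (θ k)⁻¹ + E k j * ENNReal.ofReal (θ k)⁻¹) := by
            gcongr; exact (not_le.1 hg).le
        _ = _ := by ring
  -- a ball of radius `R 2⁻ᵏ` meets only the cell of its centre and the two adjacent ones
  set J : ℕ → ℤ := fun n => ⌊2 ^ k n * x n / R⌋
  have hsub : f ⁻¹' B ⊆ (⋃ m, ⋃ j, G' (m + N) j) ∪
      ⋃ n, ⋃ j ∈ Finset.Icc (J n - 1) (J n + 1), G (k n) j := by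
    intro z hz
    obtain ⟨n, hn⟩ := mem_iUnion.1 (hrO hz)
    set j := ⌊2 ^ k n * (z : ℝ) / R⌋ with hj
    have hzP : z ∈ P (k n) j := ⟨rfl, hz⟩
    by_cases hg : good (k n) j
    · right
      refine mem_iUnion.2 ⟨n, mem_iUnion₂.2 ⟨j, ?_, hzP, hg⟩⟩
      rw [Metric.mem_ball, Real.dist_eq] at hn
      have h1 : |2 ^ k n * (z : ℝ) / R - 2 ^ k n * x n / R| < 1 := by
        rw [← sub_div, ← mul_sub, abs_div, abs_mul, abs_of_pos hR, abs_of_pos (by positivity),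
          div_lt_one hR]
        calc 2 ^ k n * |(z : ℝ) - x n| < 2 ^ k n * (R * 2⁻¹ ^ k n) := by gcongr
          _ = R := by rw [inv_pow]; field_simp
      rw [abs_lt] at h1
      have a1 := Int.floor_le (2 ^ k n * (z : ℝ) / R)
      have a2 := Int.lt_floor_add_one (2 ^ k n * (z : ℝ) / R)
      have a3 := Int.floor_le (2 ^ k n * x n / R)
      have a4 := Int.lt_floor_add_one (2 ^ k n * x n / R)
      rw [Finset.mem_Icc]
      constructor
      · have : ((J n : ℤ) : ℝ) < ((j + 2 : ℤ) : ℝ) := by push_cast; linarith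
        have := Int.cast_lt.1 this
        omega
      · have : ((j : ℤ) : ℝ) < ((J n + 2 : ℤ) : ℝ) := by push_cast; linarith
        have := Int.cast_lt.1 this
        omega
    · left
      obtain ⟨m, hm⟩ := Nat.exists_eq_add_of_le' (hkN n)
      refine mem_iUnion₂.2 ⟨m, j, ?_⟩
      rw [← hm]
      exact ⟨hzP, hg⟩
  have hocc : occupation f univ B = subtypeVolume K (f ⁻¹' B) := by
    rw [occupation, Measure.map_apply f.continuous.measurable Metric.isOpen_ball.measurableSet,
      Measure.restrict_univ]
  have hsum : ∑' n, ENNReal.ofReal (θ (k n)) ≤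
      3 * ENNReal.ofReal ((4 / R) ^ α) * ENNReal.ofReal η := by
    have h1 : ∀ n, ENNReal.ofReal (θ (k n)) ≤ ENNReal.ofReal ((4 / R) ^ α) *
        (Metric.ediam (t n) ^ α + ENNReal.ofReal η * 2⁻¹ ^ n) := by
      intro n
      refine (ENNReal.ofReal_le_ofReal (hkα n)).trans (le_of_eq ?_)
      rw [ENNReal.ofReal_mul (by positivity), ENNReal.ofReal_add (by positivity) (by positivity),
        ENNReal.ofReal_mul hη.le, ENNReal.ofReal_pow (by norm_num),
        ENNReal.ofReal_inv_of_pos (by norm_num), ENNReal.ofReal_ofNat,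
        ← ENNReal.ofReal_rpow_of_nonneg ENNReal.toReal_nonneg hα.le,
        ENNReal.ofReal_toReal (hfin n)]
    refine (ENNReal.tsum_le_tsum h1).trans ?_
    rw [ENNReal.tsum_mul_left, ENNReal.tsum_add, ENNReal.tsum_mul_left, ENNReal.tsum_geometric,
      ENNReal.one_sub_inv_two, inv_inv]
    calc _ ≤ ENNReal.ofReal ((4 / R) ^ α) * (ENNReal.ofReal η + ENNReal.ofReal η * 2) := by
          gcongr
      _ = _ := by ring
  have htotal : c * ρ ≤ 2 * C * ((∑' m, ∑' j, ENNReal.ofReal (θ (m + N))⁻¹ * E (m + N) j) +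
      9 * ENNReal.ofReal ((4 / R) ^ α) * ENNReal.ofReal η) * ρ := by
    calc c * ρ ≤ subtypeVolume K (f ⁻¹' B) := hocc ▸ hy r hr hrr
      _ ≤ (∑' m, ∑' j, subtypeVolume K (G' (m + N) j)) +
          ∑' n, ∑ j ∈ Finset.Icc (J n - 1) (J n + 1), subtypeVolume K (G (k n) j) := by
        refine (measure_mono hsub).trans ((measure_union_le _ _).trans ?_)
        refine add_le_add ((measure_iUnion_le _).trans ?_) ((measure_iUnion_le _).trans ?_)
        · exact ENNReal.tsum_le_tsum fun m => measure_iUnion_le _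
        · exact ENNReal.tsum_le_tsum fun n => measure_biUnion_finset_le _ _
      _ ≤ (∑' m, ∑' j, 2 * C * ρ * (ENNReal.ofReal (θ (m + N))⁻¹ * E (m + N) j)) +
          ∑' n, 3 * (2 * C * ρ * ENNReal.ofReal (θ (k n))) := by
        refine add_le_add (ENNReal.tsum_le_tsum fun m => ENNReal.tsum_le_tsum fun j => hG' _ _)
          (ENNReal.tsum_le_tsum fun n => ?_)
        refine (Finset.sum_le_card_nsmul _ _ _ fun j _ => hG (k n) j).trans (le_of_eq ?_)
        have : (Finset.Icc (J n - 1) (J n + 1)).card = 3 := by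
          rw [Int.card_Icc]; omega
        rw [this, nsmul_eq_mul]
        norm_num
      _ = 2 * C * ρ * ((∑' m, ∑' j, ENNReal.ofReal (θ (m + N))⁻¹ * E (m + N) j) +
          3 * ∑' n, ENNReal.ofReal (θ (k n))) := by
        simp_rw [ENNReal.tsum_mul_left]
        ring
      _ ≤ 2 * C * ρ * ((∑' m, ∑' j, ENNReal.ofReal (θ (m + N))⁻¹ * E (m + N) j) +
          3 * (3 * ENNReal.ofReal ((4 / R) ^ α) * ENNReal.ofReal η)) := by gcongr
      _ = _ := by ring
  exact (ENNReal.mul_le_mul_iff_left hρ0 hρt).1 htotal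

/-- A fibre over a point of positive lower density has dimension at least `α`, provided the
energies of the occupation measures on dyadic cells are summable with weights `2 ^ (α k)`. -/
lemma le_dimH_fiber {K : Set ℝ} [CompactSpace K] (f : C(K, V)) {R : ℝ} (hR : 0 < R)
    {α : NNReal} (hα : 0 < α)
    (hE : ∑' k, ∑' j, ENNReal.ofReal ((2⁻¹ ^ k) ^ (α : ℝ))⁻¹ *
        sobolevEnergy (occupation f (dyadicCell K R k j)) ≠ ⊤)
    {y : V} {c : ℝ≥0∞} (hc : c ≠ 0) {r₀ : ℝ} (hr₀ : 0 < r₀)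
    (hy : ∀ r : ℝ, 0 < r → r < r₀ →
      c * ENNReal.ofReal (r ^ Module.finrank ℝ V) ≤ occupation f univ (Metric.ball y r)) :
    (α : ℝ≥0∞) ≤ dimH (Subtype.val '' (f ⁻¹' {y}) : Set ℝ) := by
  obtain ⟨C, hCt, hC⟩ := measure_ball_le_sobolevEnergy (V := V)
  refine le_dimH_of_hausdorffMeasure_ne_zero fun hH => hc ?_
  have hle := fun N : ℕ => lower_density_le_cover f hR (NNReal.coe_pos.2 hα) hC hr₀ hy hH N
    (η := 1 / ((N : ℝ) + 1)) (by positivity)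
  have hlim1 := ENNReal.tendsto_sum_nat_add _ hE
  have hlim2 : Tendsto (fun N : ℕ => ENNReal.ofReal (1 / ((N : ℝ) + 1))) atTop (𝓝 0) := by
    simpa using ENNReal.tendsto_ofReal tendsto_one_div_add_atTop_nhds_zero_nat
  have hlim := ENNReal.Tendsto.const_mul (a := 2 * C)
    (hlim1.add (ENNReal.Tendsto.const_mul (a := 9 * ENNReal.ofReal ((4 / R) ^ (α : ℝ))) hlim2
      (Or.inr (by finiteness)))) (Or.inr (by finiteness))
  simp only [mul_zero, add_zero] at hlim
  exact le_antisymm (ge_of_tendsto' hlim hle) zero_le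

end Dimension

/-! ### Random series with independent coefficients -/

section BumpMeasure

open FourierTransform RealInnerProductSpace
open scoped ENNReal SchwartzMap ContDiff

variable {V : Type*} [NormedAddCommGroup V] [InnerProductSpace ℝ V] [FiniteDimensional ℝ V]
  [MeasurableSpace V] [BorelSpace V]

/-- There is a probability measure on the unit ball whose Fourier transform decays faster than a
given power: a normalised smooth bump. -/
lemma exists_measure_unitBall_fourier_decay (p : ℕ) :
    ∃ P : Measure (Metric.closedBall (0 : V) 1), IsProbabilityMeasure P ∧ ∃ C : ℝ, 1 ≤ C ∧
      ∀ ξ : V, ‖measureFourier (P.map Subtype.val) ξ‖ ≤ C * ((1 + ‖ξ‖) ^ p)⁻¹ := by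
  let φ : ContDiffBump (0 : V) := ⟨1 / 2, 1, by norm_num, by norm_num⟩
  set ψ : V → ℝ := φ.normed volume with hψ
  have hψd : ContDiff ℝ ∞ ψ := φ.contDiff_normed
  have hψc : HasCompactSupport ψ := φ.hasCompactSupport_normed
  have hψ0 : ∀ x, 0 ≤ ψ x := φ.nonneg_normed
  set P₀ : Measure V := volume.withDensity fun x => ENNReal.ofReal (ψ x) with hP₀
  have hprob : P₀ univ = 1 := by
    rw [hP₀, withDensity_apply _ MeasurableSet.univ, Measure.restrict_univ,
      ← ofReal_integral_eq_lintegral_ofReal (hψd.continuous.integrable_of_hasCompactSupport hψc)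
        (ae_of_all _ hψ0), φ.integral_normed, ENNReal.ofReal_one]
  have hball : P₀ (Metric.closedBall (0 : V) 1)ᶜ = 0 := by
    rw [hP₀, withDensity_apply _ Metric.isClosed_closedBall.measurableSet.compl]
    refine setLIntegral_eq_zero Metric.isClosed_closedBall.measurableSet.compl fun x hx => ?_
    have : x ∉ Function.support ψ := by
      rw [hψ, φ.support_normed_eq]
      exact fun h => hx (Metric.ball_subset_closedBall h)
    simp [Function.notMem_support.1 this]
  have hemb : MeasurableEmbedding (Subtype.val : Metric.closedBall (0 : V) 1 → V) :=
    MeasurableEmbedding.subtype_coe Metric.isClosed_closedBall.measurableSet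
  have hmap : (P₀.comap Subtype.val).map (Subtype.val : Metric.closedBall (0 : V) 1 → V) = P₀ := by
    rw [hemb.map_comap, Subtype.range_coe]
    exact Measure.restrict_eq_self_of_ae_mem hball
  refine ⟨P₀.comap Subtype.val, ⟨?_⟩, ?_⟩
  · rw [hemb.comap_apply, Subtype.coe_image_univ, ← hprob]
    exact measure_congr (ae_eq_univ.2 hball)
  rw [hmap]
  have hψc' : HasCompactSupport (fun x => (ψ x : ℂ)) :=
    hψc.comp_left (g := fun t : ℝ => (t : ℂ)) rfl
  set Φ : 𝓢(V, ℂ) := hψc'.toSchwartzMap (Complex.ofRealCLM.contDiff.comp hψd)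
  have hF : ∀ ξ, measureFourier P₀ ξ = (𝓕 Φ : 𝓢(V, ℂ)) ξ := by
    intro ξ
    rw [SchwartzMap.fourier_coe, measureFourier_eq, VectorFourier.fourierIntegral, Real.fourier_eq,
      hP₀, integral_withDensity_eq_integral_toReal_smul₀
        (hψd.continuous.measurable.ennreal_ofReal.aemeasurable) (by simp)]
    congr with x
    rw [ENNReal.toReal_ofReal (hψ0 x)]
    change ψ x • _ • (1 : ℂ) = _ • (ψ x : ℂ)
    rw [smul_comm, Complex.real_smul, mul_one]
    rfl
  refine ⟨max 1 (2 ^ p * (Finset.Iic (p, 0)).sup (fun m => SchwartzMap.seminorm ℝ m.1 m.2)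
    (𝓕 Φ : 𝓢(V, ℂ))), le_max_left _ _, fun ξ => ?_⟩
  have h := SchwartzMap.one_add_le_sup_seminorm_apply (𝕜 := ℝ) (m := (p, 0)) le_rfl le_rfl
    (𝓕 Φ : 𝓢(V, ℂ)) ξ
  rw [norm_iteratedFDeriv_zero, ← hF] at h
  rw [← div_eq_mul_inv, le_div_iff₀ (by positivity), mul_comm]
  exact h.trans (le_max_right _ _)

end BumpMeasure

section RandomSeries

open Filter Topology RealInnerProductSpace ProbabilityTheory

variable {V : Type*} [NormedAddCommGroup V] [InnerProductSpace ℝ V] [CompleteSpace V]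
  {ι : Type*} {K : Set ℝ}

/-- The random series `∑ bᵢ(t) ωᵢ` with coefficients `ωᵢ` in the unit ball, a continuous function
of `t` by uniform convergence. -/
noncomputable def randomSeries (b : ι → C(K, ℝ)) {a : ι → ℝ} (ha : Summable a)
    (hb : ∀ i t, |b i t| ≤ a i) (ω : ι → Metric.closedBall (0 : V) 1) : C(K, V) where
  toFun t := ∑' i, b i t • (ω i : V)
  continuous_toFun := by
    refine continuous_tsum (fun i => by fun_prop) ha fun i t => ?_
    rw [norm_smul, Real.norm_eq_abs]
    exact (mul_le_of_le_one_right (abs_nonneg _) (mem_closedBall_zero_iff.1 (ω i).2)).trans (hb i t)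

lemma continuous_uncurry_randomSeries (b : ι → C(K, ℝ)) {a : ι → ℝ} (ha : Summable a)
    (hb : ∀ i t, |b i t| ≤ a i) :
    Continuous fun q : (ι → Metric.closedBall (0 : V) 1) × K => randomSeries b ha hb q.1 q.2 := by
  refine continuous_tsum (f := fun i (q : (ι → Metric.closedBall (0 : V) 1) × K) =>
    b i q.2 • (q.1 i : V)) (fun i => by fun_prop) ha fun i q => ?_
  rw [norm_smul, Real.norm_eq_abs]
  exact (mul_le_of_le_one_right (abs_nonneg _) (mem_closedBall_zero_iff.1 (q.1 i).2)).trans (hb i q.2)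

lemma continuous_randomSeries (b : ι → C(K, ℝ)) {a : ι → ℝ} (ha : Summable a)
    (hb : ∀ i t, |b i t| ≤ a i) : Continuous (randomSeries (V := V) b ha hb) :=
  ContinuousMap.continuous_of_continuous_uncurry _ (continuous_uncurry_randomSeries b ha hb)

lemma hasSum_randomSeries (b : ι → C(K, ℝ)) {a : ι → ℝ} (ha : Summable a)
    (hb : ∀ i t, |b i t| ≤ a i) (ω : ι → Metric.closedBall (0 : V) 1) (t : K) :
    HasSum (fun i => b i t • (ω i : V)) (randomSeries b ha hb ω t) := by
  refine (Summable.of_norm_bounded ha fun i => ?_).hasSum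
  rw [norm_smul, Real.norm_eq_abs]
  exact (mul_le_of_le_one_right (abs_nonneg _) (mem_closedBall_zero_iff.1 (ω i).2)).trans (hb i t)

variable [SecondCountableTopology V] [MeasurableSpace V] [BorelSpace V] [Countable ι]

/-- The characteristic function of an increment of the random series is dominated by that of each
single term, by independence of the coefficients. -/
lemma norm_charFun_increment_le (P : Measure (Metric.closedBall (0 : V) 1))
    [IsProbabilityMeasure P] (b : ι → C(K, ℝ)) {a : ι → ℝ} (ha : Summable a)
    (hb : ∀ i t, |b i t| ≤ a i) (s t : K) (i : ι) (ζ : V) :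
    ‖∫ ω, Complex.exp (⟪randomSeries b ha hb ω s - randomSeries b ha hb ω t, ζ⟫ * Complex.I)
      ∂(Measure.infinitePi fun _ : ι => P)‖ ≤
      ‖charFun (P.map Subtype.val) ((b i s - b i t) • ζ)‖ := by
  classical
  set Δ : ι → ℝ := fun i => b i s - b i t with hΔ
  set Q := Measure.infinitePi fun _ : ι => P
  set Y : ι → (ι → Metric.closedBall (0 : V) 1) → V := fun i ω => Δ i • (ω i : V) with hY
  have hYm : ∀ i, Measurable (Y i) := fun i => by fun_prop
  have hind : iIndepFun Y Q := iIndepFun_infinitePi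
    (X := fun (i : ι) (v : Metric.closedBall (0 : V) 1) => Δ i • (v : V)) (fun i => by fun_prop)
  have hsum : ∀ ω, HasSum (fun i => Y i ω)
      (randomSeries b ha hb ω s - randomSeries b ha hb ω t) := by
    intro ω
    simpa only [hY, hΔ, sub_smul] using
      (hasSum_randomSeries b ha hb ω s).sub (hasSum_randomSeries b ha hb ω t)
  have hlim : Tendsto (fun F : Finset ι => ∫ ω, Complex.exp (⟪∑ i ∈ F, Y i ω, ζ⟫ * Complex.I) ∂Q)
      atTop (𝓝 (∫ ω, Complex.exp
        (⟪randomSeries b ha hb ω s - randomSeries b ha hb ω t, ζ⟫ * Complex.I) ∂Q)) := by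
    refine tendsto_integral_filter_of_dominated_convergence (fun _ => (1 : ℝ))
      (Eventually.of_forall fun F => ?_) (Eventually.of_forall fun F => ae_of_all _ fun ω => ?_)
      (integrable_const _) (ae_of_all _ fun ω => ?_)
    · exact Measurable.aestronglyMeasurable (by fun_prop)
    · exact (Complex.norm_exp_ofReal_mul_I _).le
    · refine (Continuous.tendsto (f := fun v : V => Complex.exp (⟪v, ζ⟫ * Complex.I))
        (by fun_prop) _).comp (hsum ω)
  refine le_of_tendsto hlim.norm ?_
  filter_upwards [eventually_ge_atTop {i}] with F hF
  have hi : i ∈ F := hF (Finset.mem_singleton_self i)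
  have h1 : ∫ ω, Complex.exp (⟪∑ i ∈ F, Y i ω, ζ⟫ * Complex.I) ∂Q =
      charFun (Q.map fun ω => ∑ i ∈ F, Y i ω) ζ := by
    rw [charFun_apply, integral_map (Measurable.aemeasurable (by fun_prop))
      (Measurable.aestronglyMeasurable (by fun_prop))]
  have h2 : charFun (Q.map (Y i)) ζ = charFun (P.map Subtype.val) (Δ i • ζ) := by
    have : Q.map (Y i) = (P.map Subtype.val).map (Δ i • ·) := by
      rw [Measure.map_map (by fun_prop) (by fun_prop),
        ← Measure.infinitePi_map_eval (fun _ : ι => P) i, Measure.map_map (by fun_prop)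
          (by fun_prop)]
      rfl
    rw [this, charFun_map_smul]
  have : ∀ i, IsProbabilityMeasure (Q.map (Y i)) := fun i =>
    Measure.isProbabilityMeasure_map (hYm i).aemeasurable
  rw [h1, (hind.restrict F).charFun_map_fun_finsetSum_eq_prod fun i _ => (hYm i).aemeasurable,
    Finset.prod_apply, norm_prod, ← h2]
  refine (Finset.prod_le_prod_of_subset_of_le_one (Finset.singleton_subset_iff.2 hi)
    (fun _ _ => norm_nonneg _) fun _ _ _ => norm_charFun_le_one _).trans (le_of_eq ?_)
  rw [Finset.prod_singleton]

end RandomSeries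

/-! ### Second moments and the trigonometric terms -/

section SecondMoment

open ComplexConjugate
open scoped ENNReal

/-- The second moment of the integral of a random bounded function is bounded by the integral of
its correlations. -/
lemma lintegral_enorm_integral_sq_le {Ω T : Type*} [MeasurableSpace Ω] [MeasurableSpace T]
    (Q : Measure Ω) (m : Measure T) [IsFiniteMeasure Q] [IsFiniteMeasure m] {u : Ω → T → ℂ}
    (hu : Measurable (Function.uncurry u)) (hb : ∀ x t, ‖u x t‖ ≤ 1) :
    ∫⁻ x, ‖∫ t, u x t ∂m‖ₑ ^ 2 ∂Q ≤
      ∫⁻ s, ∫⁻ t, ‖∫ x, u x s * conj (u x t) ∂Q‖ₑ ∂m ∂m := by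
  have hjoint : Measurable fun q : Ω × T × T => u q.1 q.2.1 * conj (u q.1 q.2.2) :=
    (hu.comp (measurable_fst.prodMk measurable_snd.fst)).mul
      (Complex.continuous_conj.measurable.comp
        (hu.comp (measurable_fst.prodMk measurable_snd.snd)))
  have hbound : ∀ x s t, ‖u x s * conj (u x t)‖ ≤ 1 := fun x s t => by
    rw [norm_mul, RCLike.norm_conj]
    exact mul_le_one₀ (hb x s) (norm_nonneg _) (hb x t)
  have hint : Integrable (Function.uncurry fun (x : Ω) (p : T × T) => u x p.1 * conj (u x p.2))
      (Q.prod (m.prod m)) :=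
    Integrable.of_bound hjoint.aestronglyMeasurable 1 (ae_of_all _ fun q => hbound _ _ _)
  have hsq : ∀ x, ∫ p : T × T, u x p.1 * conj (u x p.2) ∂(m.prod m) =
      ((‖∫ t, u x t ∂m‖ ^ 2 : ℝ) : ℂ) := by
    intro x
    rw [integral_prod_mul (fun t => u x t) (fun t => conj (u x t)), integral_conj,
      Complex.mul_conj, Complex.normSq_eq_norm_sq]
  have hmeas : Measurable fun x => ‖∫ t, u x t ∂m‖ :=
    (hu.stronglyMeasurable.integral_prod_right).measurable.norm
  have hE : Integrable (fun x => ‖∫ t, u x t ∂m‖ ^ 2) Q := by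
    have := hint.integral_prod_left
    simp only [Function.uncurry_apply_pair, hsq] at this
    exact this.re
  have h1 : ∫⁻ x, ‖∫ t, u x t ∂m‖ₑ ^ 2 ∂Q = ‖∫ x, (‖∫ t, u x t ∂m‖ ^ 2 : ℝ) ∂Q‖ₑ := by
    rw [← ofReal_norm, Real.norm_of_nonneg (integral_nonneg fun x => by positivity),
      ofReal_integral_eq_lintegral_ofReal hE (ae_of_all _ fun x => by positivity)]
    congr with x
    rw [ENNReal.ofReal_pow (norm_nonneg _), ofReal_norm]
  have h2 : ‖∫ x, (‖∫ t, u x t ∂m‖ ^ 2 : ℝ) ∂Q‖ₑ =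
      ‖∫ p : T × T, ∫ x, u x p.1 * conj (u x p.2) ∂Q ∂(m.prod m)‖ₑ := by
    rw [← integral_integral_swap hint]
    simp_rw [hsq]
    rw [integral_complex_ofReal, ← ofReal_norm, ← ofReal_norm,
      Complex.norm_real]
  rw [h1, h2]
  refine (enorm_integral_le_lintegral_enorm _).trans (le_of_eq ?_)
  refine lintegral_prod _ ?_
  have : StronglyMeasurable fun p : T × T => ∫ x, u x p.1 * conj (u x p.2) ∂Q :=
    StronglyMeasurable.integral_prod_right (f := fun (p : T × T) (x : Ω) => u x p.1 * conj (u x p.2))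
      (hjoint.comp measurable_swap).stronglyMeasurable
  exact this.measurable.enorm.aemeasurable

end SecondMoment

section Trigonometric

open Real

/-- The terms `cos (π 2ⁿ t / R) / (n + 1)²` and `sin (π 2ⁿ t / R) / (n + 1)²`, indexed by `n` and a
Boolean. -/
noncomputable def trigTerm (K : Set ℝ) (R : ℝ) (i : ℕ × Bool) : C(K, ℝ) where
  toFun t := (((i.1 : ℝ) + 1) ^ 2)⁻¹ *
    (if i.2 = true then cos (π * 2 ^ i.1 * t / R) else sin (π * 2 ^ i.1 * t / R))
  continuous_toFun := by
    rcases i with ⟨n, _ | _⟩ <;> simp only [if_true, if_false, Bool.false_eq_true] <;> fun_prop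

lemma abs_trigTerm_le {K : Set ℝ} {R : ℝ} (i : ℕ × Bool) (t : K) :
    |trigTerm K R i t| ≤ (((i.1 : ℝ) + 1) ^ 2)⁻¹ := by
  change |(((i.1 : ℝ) + 1) ^ 2)⁻¹ * _| ≤ _
  rw [abs_mul, abs_of_pos (a := (((i.1 : ℝ) + 1) ^ 2)⁻¹) (by positivity)]
  refine mul_le_of_le_one_right (by positivity) ?_
  split_ifs
  · exact abs_cos_le_one _
  · exact abs_sin_le_one _

lemma summable_trigTerm_bound : Summable fun i : ℕ × Bool => (((i.1 : ℝ) + 1) ^ 2)⁻¹ := by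
  have h : Summable fun n : ℕ => (((n : ℝ) + 1) ^ 2)⁻¹ := by
    have := (summable_nat_add_iff 1).2 (Real.summable_nat_pow_inv (p := 2).2 (by norm_num))
    simpa using this
  simpa using h.mul_of_nonneg (Summable.of_finite (f := fun _ : Bool => (1 : ℝ)))
    (fun n => by positivity) (fun _ => zero_le_one)

/-- At the scale `n` with `2ⁿ |s - t| / R` between `1/2` and `1`, the angle between the two points
lies between `π/2` and `π`, so that one of the two coordinates changes by at least `1`. -/
lemma exists_trigTerm_increment {K : Set ℝ} {R : ℝ} (hR : 0 < R) {s t : K} (hst : s ≠ t) {k : ℕ}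
    (hk : |(s : ℝ) - t| ≤ R * 2⁻¹ ^ k) :
    ∃ m : ℕ, |(s : ℝ) - t| ≤ R * 2⁻¹ ^ (m + k) ∧ ∃ β : Bool,
      ((((m + k : ℕ) : ℝ) + 1) ^ 2)⁻¹ ≤ |trigTerm K R (m + k, β) s - trigTerm K R (m + k, β) t| := by
  have hpos : 0 < |(s : ℝ) - t| := abs_pos.2 (sub_ne_zero.2 fun h => hst (Subtype.ext h))
  have hx : |(s : ℝ) - t| / R ≤ 2⁻¹ ^ k := by rw [div_le_iff₀ hR]; linarith
  obtain ⟨n, hn1, hn2⟩ := exists_nat_pow_near_of_lt_one (x := |(s : ℝ) - t| / R) (y := (2⁻¹ : ℝ))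
    (by positivity) (hx.trans (pow_le_one₀ (by norm_num) (by norm_num))) (by norm_num)
    (by norm_num)
  have hkn : k ≤ n := by
    have := (pow_lt_pow_iff_right_of_lt_one₀ (by norm_num) (by norm_num)).1 (hn1.trans_le hx)
    omega
  obtain ⟨m, rfl⟩ := Nat.exists_eq_add_of_le' hkn
  refine ⟨m, ?_, ?_⟩
  · rw [div_le_iff₀ hR] at hn2; linarith
  set N := m + k
  set x := π * 2 ^ N * s / R
  set y := π * 2 ^ N * t / R
  have hxy : |x - y| = π * (2 ^ N * (|(s : ℝ) - t| / R)) := by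
    have : x - y = π * 2 ^ N * (s - t) / R := by simp only [x, y]; ring
    rw [this, abs_div, abs_mul, abs_of_pos hR, abs_of_pos (show 0 < π * 2 ^ N by positivity)]
    ring
  have hcos : cos (x - y) ≤ 0 := by
    rw [← cos_abs, hxy]
    refine cos_nonpos_of_pi_div_two_le_of_le ?_ ?_
    · have : (1 : ℝ) / 2 ≤ 2 ^ N * (|(s : ℝ) - t| / R) := by
        calc (1 : ℝ) / 2 = 2 ^ N * 2⁻¹ ^ (N + 1) := by rw [inv_pow, pow_succ]; field_simp
          _ ≤ _ := by gcongr
      nlinarith [pi_pos]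
    · have : 2 ^ N * (|(s : ℝ) - t| / R) ≤ 1 := by
        calc _ ≤ (2 : ℝ) ^ N * 2⁻¹ ^ N := by gcongr
          _ = 1 := by rw [inv_pow]; field_simp
      nlinarith [pi_pos]
  have hsum : 2 ≤ (cos x - cos y) ^ 2 + (sin x - sin y) ^ 2 := by
    have h1 := cos_sub x y
    nlinarith [sin_sq_add_cos_sq x, sin_sq_add_cos_sq y]
  have hterm : ∀ β : Bool, |trigTerm K R (N, β) s - trigTerm K R (N, β) t| =
      (((N : ℝ) + 1) ^ 2)⁻¹ * |(if β = true then cos x else sin x) -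
        (if β = true then cos y else sin y)| := by
    intro β
    rw [← abs_of_pos (a := (((N : ℝ) + 1) ^ 2)⁻¹) (by positivity), ← abs_mul, mul_sub]
    rfl
  rcases le_total 1 ((cos x - cos y) ^ 2) with h | h
  · refine ⟨true, ?_⟩
    rw [hterm]
    exact le_mul_of_one_le_right (by positivity) (by simpa using (one_le_sq_iff_one_le_abs _).1 h)
  · refine ⟨false, ?_⟩
    rw [hterm]
    refine le_mul_of_one_le_right (by positivity) ?_
    simpa using (one_le_sq_iff_one_le_abs (sin x - sin y)).1 (by linarith)

end Trigonometric

/-! ### Expected energy of the occupation measures -/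

section Energy

open RealInnerProductSpace ComplexConjugate
open scoped ENNReal

variable {V : Type*} [NormedAddCommGroup V] [InnerProductSpace ℝ V] [FiniteDimensional ℝ V]
  [MeasurableSpace V] [BorelSpace V]

/-- The random trigonometric series with coefficients in the unit ball of `V`. -/
noncomputable def trigSeries (V : Type*) [NormedAddCommGroup V] [InnerProductSpace ℝ V]
    [CompleteSpace V] (K : Set ℝ) (R : ℝ) (x : ℕ × Bool → Metric.closedBall (0 : V) 1) : C(K, V) :=
  randomSeries (trigTerm K R) summable_trigTerm_bound abs_trigTerm_le x

lemma measureFourier_occupation {K : Set ℝ} (f : C(K, V)) (S : Set K) (ξ : V) :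
    measureFourier (occupation f S) ξ =
      ∫ t in S, Complex.exp (⟪f t, -(2 * Real.pi) • ξ⟫ * Complex.I) ∂subtypeVolume K := by
  rw [measureFourier, charFun_apply, occupation,
    integral_map f.continuous.measurable.aemeasurable
      (Measurable.aestronglyMeasurable (by fun_prop))]

lemma continuous_measureFourier_occupation {K : Set ℝ} [CompactSpace K] (S : Set K) :
    Continuous fun q : C(K, V) × V => measureFourier (occupation q.1 S) q.2 := by
  simp_rw [measureFourier_occupation]
  refine continuous_of_dominated (bound := fun _ => (1 : ℝ)) (fun q => ?_)
    (fun q => ae_of_all _ fun t => (Complex.norm_exp_ofReal_mul_I _).le) (integrable_const _)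
    (ae_of_all _ fun t => ?_)
  · exact Continuous.aestronglyMeasurable (by fun_prop)
  · fun_prop

lemma continuous_trigSeries (V : Type*) [NormedAddCommGroup V] [InnerProductSpace ℝ V]
    [CompleteSpace V] (K : Set ℝ) (R : ℝ) :
    Continuous (trigSeries V K R) :=
  continuous_randomSeries _ summable_trigTerm_bound abs_trigTerm_le

lemma subtypeVolume_abs_sub_le {K : Set ℝ} [CompactSpace K] (s : K) {ρ : ℝ} :
    subtypeVolume K {t : K | |(s : ℝ) - t| ≤ ρ} ≤ ENNReal.ofReal (2 * ρ) := by
  rw [subtypeVolume_apply, ← Real.volume_closedBall (s : ℝ)]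
  refine measure_mono ?_
  rintro _ ⟨t, ht, rfl⟩
  rw [Metric.mem_closedBall, Real.dist_eq, abs_sub_comm]
  exact ht

/-- The correlation of two values of the characters of a translated trigonometric series: the
translation only contributes a unimodular factor, so the bound does not depend on it. -/
lemma enorm_correlation_le {K : Set ℝ} {R : ℝ} (hR : 0 < R)
    (P : Measure (Metric.closedBall (0 : V) 1)) [IsProbabilityMeasure P] {p : ℕ} {C : ℝ}
    (hC1 : 1 ≤ C)
    (hC : ∀ ξ : V, ‖measureFourier (P.map Subtype.val) ξ‖ ≤ C * ((1 + ‖ξ‖) ^ p)⁻¹)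
    (g : C(K, V)) {s t : K} {k : ℕ} (hk : |(s : ℝ) - t| ≤ R * 2⁻¹ ^ k) (ξ : V) :
    ‖∫ x, Complex.exp (⟪(trigSeries V K R x + g) s, -(2 * Real.pi) • ξ⟫ * Complex.I) *
      conj (Complex.exp (⟪(trigSeries V K R x + g) t, -(2 * Real.pi) • ξ⟫ * Complex.I))
      ∂(Measure.infinitePi fun _ : ℕ × Bool => P)‖ₑ ≤
      (∑' m : ℕ, {q : K × K | |(q.1 : ℝ) - q.2| ≤ R * 2⁻¹ ^ (m + k)}.indicator
        (fun _ => ENNReal.ofReal (C * (((m + k : ℕ) : ℝ) + 1) ^ (2 * p))) (s, t)) *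
        ENNReal.ofReal ((1 + ‖ξ‖) ^ p)⁻¹ := by
  rcases eq_or_ne s t with rfl | hst
  · -- on the diagonal the series on the right diverges
    have htop : (∑' m : ℕ, {q : K × K | |(q.1 : ℝ) - q.2| ≤ R * 2⁻¹ ^ (m + k)}.indicator
        (fun _ => ENNReal.ofReal (C * (((m + k : ℕ) : ℝ) + 1) ^ (2 * p))) (s, s)) = ⊤ := by
      rw [eq_top_iff, ← ENNReal.tsum_const_eq_top_of_ne_zero (α := ℕ) one_ne_zero]
      refine ENNReal.tsum_le_tsum fun m => ?_
      rw [indicator_of_mem (by simp only [mem_ofPred_eq, sub_self, abs_zero]; positivity),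
        ENNReal.one_le_ofReal]
      exact one_le_mul_of_one_le_of_one_le hC1 (one_le_pow₀ (le_add_of_nonneg_left (Nat.cast_nonneg _)))
    rw [htop, ENNReal.top_mul]
    · exact le_top
    · simp only [ne_eq, ENNReal.ofReal_eq_zero, not_le]
      positivity
  obtain ⟨m, hm, β, hβ⟩ := exists_trigTerm_increment hR hst hk
  set N := m + k
  set Δ := trigTerm K R (N, β) s - trigTerm K R (N, β) t
  set η := -(2 * Real.pi) • ξ with hη
  have hprod : ∀ x, Complex.exp (⟪(trigSeries V K R x + g) s, η⟫ * Complex.I) *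
      conj (Complex.exp (⟪(trigSeries V K R x + g) t, η⟫ * Complex.I)) =
      Complex.exp (⟪trigSeries V K R x s - trigSeries V K R x t, η⟫ * Complex.I) *
        Complex.exp (⟪g s - g t, η⟫ * Complex.I) := by
    intro x
    rw [← Complex.exp_conj, ← Complex.exp_add, ← Complex.exp_add, map_mul, Complex.conj_I,
      Complex.conj_ofReal]
    congr 1
    simp only [ContinuousMap.add_apply, inner_add_left, inner_sub_left]
    push_cast
    ring
  have hnorm : ‖∫ x, Complex.exp (⟪(trigSeries V K R x + g) s, η⟫ * Complex.I) *
      conj (Complex.exp (⟪(trigSeries V K R x + g) t, η⟫ * Complex.I))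
      ∂(Measure.infinitePi fun _ : ℕ × Bool => P)‖ ≤
      C * ((N : ℝ) + 1) ^ (2 * p) * ((1 + ‖ξ‖) ^ p)⁻¹ := by
    simp_rw [hprod]
    rw [integral_mul_const, norm_mul, Complex.norm_exp_ofReal_mul_I, mul_one]
    refine (norm_charFun_increment_le P (trigTerm K R) summable_trigTerm_bound abs_trigTerm_le
      s t (N, β) η).trans ?_
    have hsc : charFun (P.map Subtype.val) (Δ • η) = measureFourier (P.map Subtype.val) (Δ • ξ) := by
      rw [measureFourier, hη, smul_comm]
    rw [hsc, mul_assoc]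
    refine (hC _).trans (mul_le_mul_of_nonneg_left ?_ (by linarith))
    rw [pow_mul, ← inv_pow, ← inv_pow, ← mul_pow, inv_pow, ← inv_pow]
    refine pow_le_pow_left₀ (by positivity) ?_ p
    rw [inv_le_comm₀ (by positivity) (by positivity), mul_inv, inv_inv, norm_smul,
      Real.norm_eq_abs]
    have h1 : (((N : ℝ) + 1) ^ 2)⁻¹ ≤ 1 := inv_le_one_of_one_le₀ (one_le_pow₀ (by simp))
    nlinarith [norm_nonneg ξ, mul_le_mul_of_nonneg_right hβ (norm_nonneg ξ)]
  rw [← ofReal_norm]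
  refine (ENNReal.ofReal_le_ofReal hnorm).trans ?_
  rw [ENNReal.ofReal_mul (by positivity)]
  gcongr
  refine le_trans (le_of_eq ?_) (ENNReal.le_tsum m)
  rw [indicator_of_mem (by exact hm)]

/-- The correlation bound is integrated shell by shell: `m + k + 1 ≤ (m + 1) (k + 1)` separates the
polynomial factor, and the geometric factor makes the sum over `m` converge. -/
lemma lintegral_correlation_bound_le {K : Set ℝ} [CompactSpace K] {R : ℝ} (hR : 0 < R) (p : ℕ)
    {C : ℝ} (hC : 0 ≤ C) (k : ℕ) (S : Set K) (s : K) :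
    ∫⁻ t in S, ∑' m : ℕ, {q : K × K | |(q.1 : ℝ) - q.2| ≤ R * 2⁻¹ ^ (m + k)}.indicator
        (fun _ => ENNReal.ofReal (C * (((m + k : ℕ) : ℝ) + 1) ^ (2 * p))) (s, t)
        ∂subtypeVolume K ≤
      ENNReal.ofReal (2 * R * C) * (∑' m : ℕ, ENNReal.ofReal (((m : ℝ) + 1) ^ (2 * p) * 2⁻¹ ^ m)) *
        ENNReal.ofReal (((k : ℝ) + 1) ^ (2 * p) * 2⁻¹ ^ k) := by
  have hms : ∀ m : ℕ, MeasurableSet {t : K | |(s : ℝ) - t| ≤ R * 2⁻¹ ^ (m + k)} := fun m =>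
    measurableSet_le (by fun_prop) measurable_const
  have hind : ∀ (m : ℕ) (t : K), {q : K × K | |(q.1 : ℝ) - q.2| ≤ R * 2⁻¹ ^ (m + k)}.indicator
        (fun _ => ENNReal.ofReal (C * (((m + k : ℕ) : ℝ) + 1) ^ (2 * p))) (s, t) =
      {t : K | |(s : ℝ) - t| ≤ R * 2⁻¹ ^ (m + k)}.indicator
        (fun _ => ENNReal.ofReal (C * (((m + k : ℕ) : ℝ) + 1) ^ (2 * p))) t := fun _ _ => rfl
  refine (setLIntegral_le_lintegral S _).trans ?_
  simp_rw [hind]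
  rw [lintegral_tsum fun m => (measurable_const.indicator (hms m)).aemeasurable,
    ← ENNReal.tsum_mul_left, ← ENNReal.tsum_mul_right]
  refine ENNReal.tsum_le_tsum fun m => ?_
  rw [lintegral_indicator_const (hms m)]
  refine (mul_le_mul_right (subtypeVolume_abs_sub_le s) _).trans ?_
  rw [← ENNReal.ofReal_mul (by positivity), ← ENNReal.ofReal_mul (by positivity),
    ← ENNReal.ofReal_mul (by positivity)]
  apply ENNReal.ofReal_le_ofReal
  have h1 : ((m + k : ℕ) : ℝ) + 1 ≤ ((m : ℝ) + 1) * ((k : ℝ) + 1) := by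
    push_cast
    nlinarith [mul_nonneg (Nat.cast_nonneg (α := ℝ) m) (Nat.cast_nonneg (α := ℝ) k)]
  calc C * (((m + k : ℕ) : ℝ) + 1) ^ (2 * p) * (2 * (R * 2⁻¹ ^ (m + k)))
      ≤ C * (((m : ℝ) + 1) * ((k : ℝ) + 1)) ^ (2 * p) * (2 * (R * 2⁻¹ ^ (m + k))) := by gcongr
    _ = _ := by rw [mul_pow, pow_add]; ring

/-- The expected energy of the occupation measure of a translated trigonometric series on a set of
diameter `R 2⁻ᵏ` is of order `λ(S) 2⁻ᵏ` up to a polynomial factor, uniformly in the translation. -/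
lemma exists_lintegral_sobolevEnergy_le (V : Type*) [NormedAddCommGroup V] [InnerProductSpace ℝ V]
    [FiniteDimensional ℝ V] [MeasurableSpace V] [BorelSpace V] (K : Set ℝ) [CompactSpace K] {R : ℝ}
    (hR : 0 < R) :
    ∃ P : Measure (Metric.closedBall (0 : V) 1), IsProbabilityMeasure P ∧ ∃ (C : ℝ≥0∞) (p : ℕ),
      C ≠ ⊤ ∧ ∀ (g : C(K, V)) (k : ℕ) (S : Set K), MeasurableSet S →
        (∀ s ∈ S, ∀ t ∈ S, |(s : ℝ) - t| ≤ R * 2⁻¹ ^ k) →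
        ∫⁻ x, sobolevEnergy (occupation (trigSeries V K R x + g) S)
            ∂(Measure.infinitePi fun _ : ℕ × Bool => P) ≤
          C * ENNReal.ofReal (((k : ℝ) + 1) ^ p * 2⁻¹ ^ k) * subtypeVolume K S := by
  set D := Module.finrank ℝ V with hD
  set p := (D + 1) + (D + 1) with hp
  obtain ⟨P, hP, C₀, hC1, hC₀⟩ := exists_measure_unitBall_fourier_decay (V := V) p
  set W : ℝ≥0∞ := ∫⁻ ξ : V, ENNReal.ofReal ((1 + ‖ξ‖) ^ (-((D : ℝ) + 1))) with hW
  have hWfin : W ≠ ⊤ := (finite_integral_one_add_norm (by simp [D])).ne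
  set A : ℝ≥0∞ := ∑' m : ℕ, ENNReal.ofReal (((m : ℝ) + 1) ^ (2 * p) * 2⁻¹ ^ m) with hA
  have hAfin : A ≠ ⊤ := by
    have h1 : Summable fun m : ℕ => ((m : ℝ) + 1) ^ (2 * p) * 2⁻¹ ^ m := by
      have h2 := ((summable_nat_add_iff 1).2 (summable_pow_mul_geometric_of_norm_lt_one
        (R := ℝ) (2 * p) (r := 2⁻¹) (by norm_num))).mul_right 2
      refine h2.congr fun m => ?_
      rw [pow_succ]; push_cast; ring
    exact h1.tsum_ofReal_ne_top
  refine ⟨P, hP, W * (ENNReal.ofReal (2 * R * C₀) * A), 2 * p, by finiteness,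
    fun g k S hS hdiam => ?_⟩
  set Q := Measure.infinitePi fun _ : ℕ × Bool => P
  set κ : ℝ≥0∞ := ENNReal.ofReal (2 * R * C₀) * A *
    ENNReal.ofReal (((k : ℝ) + 1) ^ (2 * p) * 2⁻¹ ^ k) with hκ
  have hmom : ∀ ξ : V, ∫⁻ x, ‖measureFourier (occupation (trigSeries V K R x + g) S) ξ‖ₑ ^ 2 ∂Q ≤
      κ * subtypeVolume K S * ENNReal.ofReal ((1 + ‖ξ‖) ^ p)⁻¹ := by
    intro ξ
    simp_rw [measureFourier_occupation]
    have hu : Continuous (Function.uncurry fun (x : ℕ × Bool → Metric.closedBall (0 : V) 1)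
        (t : K) => Complex.exp (⟪(trigSeries V K R x + g) t, -(2 * Real.pi) • ξ⟫ * Complex.I)) := by
      have h1 : Continuous fun v : V => Complex.exp (⟪v, -(2 * Real.pi) • ξ⟫ * Complex.I) := by
        fun_prop
      have h2 : Continuous fun x => trigSeries V K R x + g :=
        (continuous_trigSeries V K R).add continuous_const
      exact h1.comp (continuous_eval.comp ((h2.comp continuous_fst).prodMk continuous_snd))
    refine (lintegral_enorm_integral_sq_le Q _ hu.measurable
      fun x t => (Complex.norm_exp_ofReal_mul_I _).le).trans ?_
    calc _ ≤ ∫⁻ s in S, κ * ENNReal.ofReal ((1 + ‖ξ‖) ^ p)⁻¹ ∂subtypeVolume K := by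
          refine setLIntegral_mono' hS fun s hs => ?_
          refine (setLIntegral_mono' hS fun t ht =>
            enorm_correlation_le hR P hC1 hC₀ g (hdiam s hs t ht) ξ).trans ?_
          rw [lintegral_mul_const' _ _ ENNReal.ofReal_ne_top]
          gcongr
          exact lintegral_correlation_bound_le hR p (by linarith) k S s
      _ = _ := by
          rw [setLIntegral_const]
          ring
  have hmeas : Measurable fun q : (ℕ × Bool → Metric.closedBall (0 : V) 1) × V =>
      ENNReal.ofReal ((1 + ‖q.2‖) ^ (D + 1)) *
        ‖measureFourier (occupation (trigSeries V K R q.1 + g) S) q.2‖ₑ ^ 2 := by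
    refine Measurable.mul (by fun_prop) (Measurable.pow_const (Measurable.enorm ?_) 2)
    exact ((continuous_measureFourier_occupation S).comp
      ((((continuous_trigSeries V K R).add continuous_const).comp continuous_fst).prodMk
        continuous_snd)).measurable
  calc ∫⁻ x, sobolevEnergy (occupation (trigSeries V K R x + g) S) ∂Q
      = ∫⁻ ξ, ∫⁻ x, ENNReal.ofReal ((1 + ‖ξ‖) ^ (D + 1)) *
          ‖measureFourier (occupation (trigSeries V K R x + g) S) ξ‖ₑ ^ 2 ∂Q := by
        simp_rw [sobolevEnergy]
        exact lintegral_lintegral_swap (f := fun (x : ℕ × Bool → Metric.closedBall (0 : V) 1)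
          (ξ : V) => ENNReal.ofReal ((1 + ‖ξ‖) ^ (D + 1)) *
            ‖measureFourier (occupation (trigSeries V K R x + g) S) ξ‖ₑ ^ 2) hmeas.aemeasurable
    _ ≤ ∫⁻ ξ : V, κ * subtypeVolume K S * ENNReal.ofReal ((1 + ‖ξ‖) ^ (-((D : ℝ) + 1))) := by
        refine lintegral_mono fun ξ => ?_
        rw [lintegral_const_mul' _ _ ENNReal.ofReal_ne_top]
        refine (mul_le_mul_right (hmom ξ) _).trans (le_of_eq ?_)
        rw [mul_left_comm, ← ENNReal.ofReal_mul (by positivity)]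
        congr 2
        have : (1 + ‖ξ‖) ^ (-((D : ℝ) + 1)) = ((1 + ‖ξ‖) ^ (D + 1))⁻¹ := by
          rw [Real.rpow_neg (by positivity)]
          norm_cast
        rw [this, hp, pow_add (1 + ‖ξ‖) (D + 1) (D + 1)]
        have : (1 + ‖ξ‖) ^ (D + 1) ≠ 0 := by positivity
        field_simp
    _ = κ * subtypeVolume K S * W := by
        rw [lintegral_const_mul' _ _ (by finiteness)]
    _ = _ := by rw [hκ]; ring

end Energy

/-! ### Total energy and prevalence -/

section TotalEnergy

open Filter Topology
open scoped ENNReal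

variable {V : Type*} [NormedAddCommGroup V] [InnerProductSpace ℝ V] [FiniteDimensional ℝ V]
  [MeasurableSpace V] [BorelSpace V]

/-- The energy of the whole occupation measure of `f` together with a weighted sum of the energies
of its occupation measures on all dyadic cells. The weights `2ᵏ / (k + 1) ^ (p + 2)` are almost
the largest for which the sum is finite in expectation. -/
noncomputable def totalEnergy (K : Set ℝ) (R : ℝ) (p : ℕ) (f : C(K, V)) : ℝ≥0∞ :=
  sobolevEnergy (occupation f univ) + ∑' k : ℕ, ∑' j : ℤ,
    ENNReal.ofReal (2 ^ k / ((k : ℝ) + 1) ^ (p + 2)) *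
      sobolevEnergy (occupation f (dyadicCell K R k j))

lemma measurable_sobolevEnergy_occupation {K : Set ℝ} [CompactSpace K]
    [MeasurableSpace C(K, V)] [BorelSpace C(K, V)] (S : Set K) :
    Measurable fun f : C(K, V) => sobolevEnergy (occupation f S) := by
  refine Measurable.lintegral_prod_right' (f := fun q : C(K, V) × V =>
    ENNReal.ofReal ((1 + ‖q.2‖) ^ (Module.finrank ℝ V + 1)) *
      ‖measureFourier (occupation q.1 S) q.2‖ₑ ^ 2) ?_
  exact Measurable.mul (by fun_prop)
    ((continuous_measureFourier_occupation S).measurable.enorm.pow_const 2)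

lemma measurable_totalEnergy (K : Set ℝ) [CompactSpace K] (R : ℝ) (p : ℕ)
    [MeasurableSpace C(K, V)] [BorelSpace C(K, V)] :
    Measurable (totalEnergy (V := V) K R p) :=
  (measurable_sobolevEnergy_occupation univ).add <| Measurable.tsum fun _ =>
    Measurable.tsum fun _ => (measurable_sobolevEnergy_occupation _).const_mul _

lemma tsum_subtypeVolume_dyadicCell (K : Set ℝ) (R : ℝ) (k : ℕ) :
    ∑' j, subtypeVolume K (dyadicCell K R k j) = subtypeVolume K univ := by
  rw [← measure_iUnion _ fun j => measurableSet_dyadicCell K R k j]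
  · congr 1
    exact eq_univ_of_forall fun x => mem_iUnion.2 ⟨_, rfl⟩
  · intro i j hij
    refine Set.disjoint_left.2 fun x hi hj => hij ?_
    rw [← show ⌊2 ^ k * (x : ℝ) / R⌋ = i from hi]
    exact hj

lemma abs_sub_le_of_mem_dyadicCell {K : Set ℝ} {R : ℝ} (hR : 0 < R) {k : ℕ} {j : ℤ} {s t : K}
    (hs : s ∈ dyadicCell K R k j) (ht : t ∈ dyadicCell K R k j) :
    |(s : ℝ) - t| ≤ R * 2⁻¹ ^ k := by
  have h := Int.abs_sub_lt_one_of_floor_eq_floor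
    ((show ⌊2 ^ k * (s : ℝ) / R⌋ = j from hs).trans (show ⌊2 ^ k * (t : ℝ) / R⌋ = j from ht).symm)
  rw [← sub_div, ← mul_sub, abs_div, abs_mul, abs_of_pos hR, abs_of_pos (by positivity),
    div_lt_one hR] at h
  rw [inv_pow, ← div_eq_mul_inv, le_div_iff₀ (by positivity)]
  linarith

/-- A random trigonometric series, translated by any fixed function, has finite total energy
almost surely. -/
lemma exists_ae_totalEnergy_ne_top (V : Type*) [NormedAddCommGroup V] [InnerProductSpace ℝ V]
    [FiniteDimensional ℝ V] [MeasurableSpace V] [BorelSpace V] (K : Set ℝ) [CompactSpace K] {R : ℝ}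
    (hR : 0 < R) (hKR : ∀ s t : K, |(s : ℝ) - t| ≤ R) :
    ∃ P : Measure (Metric.closedBall (0 : V) 1), IsProbabilityMeasure P ∧ ∃ p : ℕ,
      ∀ g : C(K, V), ∀ᵐ x ∂(Measure.infinitePi fun _ : ℕ × Bool => P),
        totalEnergy K R p (trigSeries V K R x + g) ≠ ⊤ := by
  obtain ⟨P, hP, C, p, hC, hle⟩ := exists_lintegral_sobolevEnergy_le V K hR
  refine ⟨P, hP, p, fun g => ?_⟩
  let _ : MeasurableSpace C(K, V) := borel _
  have _ : BorelSpace C(K, V) := ⟨rfl⟩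
  have hX : Measurable fun x => trigSeries V K R x + g :=
    ((continuous_trigSeries V K R).add continuous_const).measurable
  have hm : ∀ S : Set K, Measurable fun x => sobolevEnergy (occupation (trigSeries V K R x + g) S) :=
    fun S => (measurable_sobolevEnergy_occupation S).comp hX
  suffices h : ∫⁻ x, totalEnergy K R p (trigSeries V K R x + g)
      ∂(Measure.infinitePi fun _ : ℕ × Bool => P) ≠ ⊤ by
    filter_upwards [ae_lt_top ((measurable_totalEnergy K R p).comp hX) h] with x hx
    exact hx.ne
  have hsq : ∑' k : ℕ, ENNReal.ofReal (((k : ℝ) + 1) ^ 2)⁻¹ ≠ ⊤ := by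
    have h1 : Summable fun n : ℕ => (((n : ℝ) + 1) ^ 2)⁻¹ := by
      have := (summable_nat_add_iff 1).2 (Real.summable_nat_pow_inv (p := 2).2 (by norm_num))
      simpa using this
    exact h1.tsum_ofReal_ne_top
  have hfin : subtypeVolume K univ ≠ ⊤ := measure_ne_top _ _
  refine ne_top_of_le_ne_top (b := C * subtypeVolume K univ +
    (∑' k : ℕ, ENNReal.ofReal (((k : ℝ) + 1) ^ 2)⁻¹) * (C * subtypeVolume K univ))
    (by finiteness) ?_
  simp_rw [totalEnergy]
  rw [lintegral_add_left (hm univ), lintegral_tsum fun k =>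
    (Measurable.tsum fun j => (hm _).const_mul _).aemeasurable, ← ENNReal.tsum_mul_right]
  refine add_le_add ?_ (ENNReal.tsum_le_tsum fun k => ?_)
  · simpa using hle g 0 univ MeasurableSet.univ fun s _ t _ => by simpa using hKR s t
  · rw [lintegral_tsum fun j => ((hm _).const_mul _).aemeasurable,
      ← tsum_subtypeVolume_dyadicCell K R k, ← ENNReal.tsum_mul_left, ← ENNReal.tsum_mul_left]
    refine ENNReal.tsum_le_tsum fun j => ?_
    rw [lintegral_const_mul' _ _ ENNReal.ofReal_ne_top]
    refine (mul_le_mul_right (hle g k _ (measurableSet_dyadicCell K R k j)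
      fun s hs t ht => abs_sub_le_of_mem_dyadicCell hR hs ht) _).trans (le_of_eq ?_)
    have h1 : (2 : ℝ) ^ k / ((k : ℝ) + 1) ^ (p + 2) * (((k : ℝ) + 1) ^ p * 2⁻¹ ^ k) =
        (((k : ℝ) + 1) ^ 2)⁻¹ := by
      rw [inv_pow, pow_add]
      field_simp
    have h2 := congrArg ENNReal.ofReal h1
    rw [ENNReal.ofReal_mul (by positivity)] at h2
    rw [← h2]
    ring

/-- The weights `2 ^ (α k)` are dominated by those of `totalEnergy` when `α < 1`. -/
lemma exists_rpow_dyadic_le {α : ℝ} (hα : α < 1) (q : ℕ) :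
    ∃ A : ℝ, 0 ≤ A ∧ ∀ k : ℕ, ((2⁻¹ ^ k : ℝ) ^ α)⁻¹ ≤ A * (2 ^ k / ((k : ℝ) + 1) ^ q) := by
  set r : ℝ := 2 ^ (α - 1) with hr
  have hr0 : 0 < r := by positivity
  have hr1 : r < 1 := Real.rpow_lt_one_of_one_lt_of_neg (by norm_num) (by linarith)
  have hsum : Summable fun k : ℕ => ((k : ℝ) + 1) ^ q * r ^ k := by
    have h2 := ((summable_nat_add_iff 1).2 (summable_pow_mul_geometric_of_norm_lt_one
      (R := ℝ) q (r := r) (by rwa [Real.norm_of_nonneg hr0.le]))).mul_right r⁻¹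
    refine h2.congr fun m => ?_
    rw [pow_succ r]
    push_cast
    field_simp
  refine ⟨∑' k : ℕ, ((k : ℝ) + 1) ^ q * r ^ k, tsum_nonneg fun k => by positivity, fun k => ?_⟩
  have h1 := hsum.le_tsum k fun j _ => by positivity
  have h2 : ((2⁻¹ ^ k : ℝ) ^ α)⁻¹ = r ^ k * 2 ^ k := by
    rw [hr, ← mul_pow, ← Real.rpow_add_one (by norm_num), sub_add_cancel, ← Real.rpow_natCast,
      ← Real.rpow_mul (by norm_num), mul_comm, Real.rpow_mul (by norm_num), Real.rpow_natCast,
      Real.inv_rpow (by norm_num), inv_pow, inv_inv]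
  rw [h2]
  calc r ^ k * 2 ^ k = (((k : ℝ) + 1) ^ q * r ^ k) * (2 ^ k / ((k : ℝ) + 1) ^ q) := by field_simp
    _ ≤ _ := by gcongr

/-- Finite total energy forces the fibres over a set of full occupation measure to have
dimension one. -/
lemma exists_isOpen_dimH_fiber_eq_one {K : Set ℝ} [CompactSpace K] {R : ℝ} (hR : 0 < R) {p : ℕ}
    (f : C(K, V)) (hf : totalEnergy K R p f ≠ ⊤) :
    ∃ U : Set V, IsOpen U ∧ volume (Subtype.val '' (f ⁻¹' U) : Set ℝ) = volume K ∧
      ∀ y ∈ U, dimH (Subtype.val '' (f ⁻¹' {y}) : Set ℝ) = 1 := by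
  obtain ⟨hf1, hf2⟩ := ENNReal.add_ne_top.1 hf
  obtain ⟨U, hU, hU0, hUy⟩ := exists_isOpen_ball_lower_bound (occupation f univ) hf1
  refine ⟨U, hU, ?_, fun y hy => le_antisymm ?_ ?_⟩
  · rw [← subtypeVolume_apply]
    have h1 : subtypeVolume K (f ⁻¹' U)ᶜ = 0 := by
      rwa [occupation, Measure.restrict_univ, Measure.map_apply f.continuous.measurable
        hU.measurableSet.compl] at hU0
    rw [measure_congr (ae_eq_univ.2 h1), subtypeVolume_apply, Subtype.coe_image_univ]
  · exact (dimH_mono (subset_univ _)).trans Real.dimH_univ.le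
  · obtain ⟨c, hc, r₀, hr₀, hball⟩ := hUy y hy
    refine le_of_forall_lt_imp_le_of_dense fun a ha => ?_
    lift a to NNReal using (ha.trans ENNReal.one_lt_top).ne
    rcases eq_zero_or_pos a with rfl | ha0
    · simp
    obtain ⟨A, hA0, hA⟩ := exists_rpow_dyadic_le (α := (a : ℝ)) (by exact_mod_cast ha) (p + 2)
    refine le_dimH_fiber f hR ha0 (ne_top_of_le_ne_top
      (ENNReal.mul_ne_top (ENNReal.ofReal_ne_top (r := A)) hf2) ?_) hc hr₀ hball
    simp_rw [← ENNReal.tsum_mul_left]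
    refine ENNReal.tsum_le_tsum fun k => ENNReal.tsum_le_tsum fun j => ?_
    rw [← mul_assoc, ← ENNReal.ofReal_mul hA0]
    gcongr
    exact hA k

end TotalEnergy

theorem theorem4p1 (K : Set ℝ) [CompactSpace K] (hK : 0 < volume K) (d : ℕ) (hd : 1 ≤ d) :
    IsPrevalent {f : C(K, Fin d → ℝ) | ∃ U : Set (Fin d → ℝ), IsOpen U ∧
      volume (Subtype.val '' (f ⁻¹' U) : Set ℝ) = volume K ∧
      ∀ y ∈ U, dimH (Subtype.val '' (f ⁻¹' {y}) : Set ℝ) = 1} := by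
  obtain ⟨R, hR, hKR⟩ : ∃ R : ℝ, 0 < R ∧ ∀ s t : K, |(s : ℝ) - t| ≤ R := by
    have hb : Bornology.IsBounded K := (isCompact_iff_compactSpace.2 inferInstance).isBounded
    exact ⟨Metric.diam K + 1, by positivity, fun s t => (Real.dist_eq _ _ ▸
      Metric.dist_le_diam_of_mem hb s.2 t.2).trans (by linarith)⟩
  let L := PiLp.continuousLinearEquiv 2 ℝ (fun _ : Fin d => ℝ)
  let toEuc : C(K, Fin d → ℝ) → C(K, EuclideanSpace ℝ (Fin d)) :=
    fun f => (L.symm : C(Fin d → ℝ, EuclideanSpace ℝ (Fin d))).comp f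
  let ofEuc : C(K, EuclideanSpace ℝ (Fin d)) → C(K, Fin d → ℝ) :=
    fun f => (L : C(EuclideanSpace ℝ (Fin d), Fin d → ℝ)).comp f
  have hto : Continuous toEuc := ContinuousMap.continuous_postcomp _
  have hof : Continuous ofEuc := ContinuousMap.continuous_postcomp _
  obtain ⟨P, hP, p, hae⟩ := exists_ae_totalEnergy_ne_top (EuclideanSpace ℝ (Fin d)) K hR hKR
  let _ : MeasurableSpace C(K, Fin d → ℝ) := borel _
  have _ : BorelSpace C(K, Fin d → ℝ) := ⟨rfl⟩
  let _ : MeasurableSpace C(K, EuclideanSpace ℝ (Fin d)) := borel _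
  have _ : BorelSpace C(K, EuclideanSpace ℝ (Fin d)) := ⟨rfl⟩
  have hX : Measurable fun x => ofEuc (trigSeries (EuclideanSpace ℝ (Fin d)) K R x) :=
    (hof.comp (continuous_trigSeries _ K R)).measurable
  have hZ : Measurable fun f => totalEnergy K R p (toEuc f) :=
    (measurable_totalEnergy K R p).comp hto.measurable
  have hB : MeasurableSet {f | totalEnergy K R p (toEuc f) = ⊤} := hZ (measurableSet_singleton ⊤)
  refine ⟨{f | totalEnergy K R p (toEuc f) = ⊤}, (Measure.infinitePi fun _ : ℕ × Bool => P).map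
    fun x => ofEuc (trigSeries (EuclideanSpace ℝ (Fin d)) K R x),
    hB, fun f hf => ?_, Measure.isProbabilityMeasure_map hX.aemeasurable,
    fun g => ?_⟩
  · by_contra hfin
    obtain ⟨U, hU, hvol, hdim⟩ := exists_isOpen_dimH_fiber_eq_one hR (toEuc f) hfin
    refine hf ⟨L.symm ⁻¹' U, hU.preimage L.symm.continuous, hvol, fun y hy => ?_⟩
    rw [← hdim (L.symm y) hy]
    congr 2
    ext z
    exact L.symm.injective.eq_iff.symm
  · have himg : (fun b => b + g) '' {f | totalEnergy K R p (toEuc f) = ⊤} =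
        (fun f => f - g) ⁻¹' {f | totalEnergy K R p (toEuc f) = ⊤} := by
      rw [image_add_right]
      simp [sub_eq_add_neg]
    have hsub : Measurable fun f : C(K, Fin d → ℝ) => f - g :=
      Continuous.measurable (by fun_prop)
    rw [himg, Measure.map_apply hX (hsub hB)]
    have h := hae (-toEuc g)
    rw [ae_iff] at h
    simp only [ne_eq, not_not] at h
    convert h using 3 with x
    ext x
    have : toEuc (ofEuc (trigSeries (EuclideanSpace ℝ (Fin d)) K R x) - g) =
        trigSeries (EuclideanSpace ℝ (Fin d)) K R x + -toEuc g := by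
      ext1 t
      simp [toEuc, ofEuc, sub_eq_add_neg]
    change totalEnergy K R p _ = ⊤ ↔ _
    rw [this]
    rfl
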